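/- Let $g\ge 0$, $\delta\ge 1$ and $d\ge 0$ be integers and let $p=\sum_{|w|\le d}p_w\,w$ be a $\delta\times\delta$ matrix of polynomials, with real coefficients and of degree at most $d$, in the non-commuting variables $x=(x_1,\dots,x_g)$ (so $w$ runs over the words in the $x_j$ of length $|w|\le d$ and $p_w\in M_\delta(\mathbb R)$). Suppose $p$ is symmetric: $p^T=\sum p_w^T w^T=p$, where $w^T$ is the word $w$ reversed. For $n\ge1$ let $\mathbb S_n(\mathbb R^g)$ be the set of $g$-tuples $X=(X_1,\dots,X_g)$ of real symmetric $n\times n$ matrices, let $p(X)=\sum p_w\otimes w(X)$, and let $p(0)=p_\emptyset$ be the constant term. For a symmetric matrix polynomial $q$ let $\mathcal D_q=(\mathcal D_q(n))_{n\ge1}$, where $\mathcal D_q(n)$ is the connected component of $0$ in $\{X\in\mathbb S_n(\mathbb R^g): q(X)\text{ is invertible}\}$. Assume that (i) $p(0)$ is invertible; (ii) $\mathcal D_p$ is bounded: there is a constant $K$ such that $\sum_{j}\|X_j\|\le K$ (operator norms) for all $n\ge1$ and all $X\in\mathcal D_p(n)$; (iii) $\mathcal D_p$ is convex: $\mathcal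 D_p(n)$ is convex for every $n\ge1$. Let $\nu=\delta\sum_{j=0}^{d}g^j$ (with $0^0=1$). Then there are an integer $1\le\mu\le\frac{\nu(\nu+1)}2$ and real symmetric $\mu\times\mu$ matrices $A_1,\dots,A_g$ such that the monic affine linear pencil $L=I_\mu-\sum_{j=1}^g A_jx_j$ satisfies $\mathcal D_p=\mathcal D_L$, that is, $\mathcal D_p(n)=\mathcal D_L(n)$ for every $n\ge1$. If moreover $p(0)=I_\delta$, then such $\mu$ and $A_1,\dots,A_g$ exist with $1\le\mu\le\frac{\breve\nu(\breve\nu+1)}2$, where $\breve\nu=\delta\sum_{j=0}^{\lfloor d/2\rfloor}g^j$. -/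

import Mathlib

open scoped Matrix

namespace NCPoly

/-- `δ × δ'` matrices of polynomials, with real coefficients, in the `g` non-commuting
variables `x₁, …, x_g`. -/
abbrev MatPoly (g δ δ' : ℕ) : Type :=
  Matrix (Fin δ) (Fin δ') (FreeAlgebra ℝ (Fin g))

/-- The space of nc polynomials in `g` variables of (total) degree at most `d`: the real span
of the words of length at most `d`. -/
def degreeLE (g d : ℕ) : Submodule ℝ (FreeAlgebra ℝ (Fin g)) :=
  Submodule.span ℝ
    {m | ∃ w : List (Fin g), w.length ≤ d ∧ m = (w.map (FreeAlgebra.ι ℝ)).prod}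

/-- Every entry of `p` has degree at most `d`. -/
def MatPoly.HasDegreeLE {g δ δ' : ℕ} (p : MatPoly g δ δ') (d : ℕ) : Prop :=
  ∀ i j, p i j ∈ degreeLE g d

/-- `p` is symmetric, `pᵀ = p`, for the involution which transposes the coefficient matrices and
reverses words. On `FreeAlgebra` Mathlib's `star` is the `ℝ`-linear map reversing words (it fixes
the variables), so that `pᴴ` is the matrix polynomial with entries `(pᴴ) i j = star (p j i)`. -/
def MatPoly.IsSymmetric {g δ : ℕ} (p : MatPoly g δ δ) : Prop :=
  pᴴ = p

/-- The value of `p` at a tuple `X` of `n × n` matrices, a block matrix with `n × n` blocks: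
the block in position `(i, j)` is `p i j` with `X₁, …, X_g` substituted for the variables.
Equivalently it is `∑ p_w ⊗ w(X)`. -/
noncomputable def MatPoly.eval {g δ δ' n : ℕ} (p : MatPoly g δ δ')
    (X : Fin g → Matrix (Fin n) (Fin n) ℝ) :
    Matrix (Fin δ × Fin n) (Fin δ' × Fin n) ℝ :=
  Matrix.comp _ _ _ _ _ (p.map (FreeAlgebra.lift ℝ X))

/-- `p(0)`, the value of `p` at `0 ∈ ℝ^g`, that is, the coefficient of the empty word. -/
noncomputable def MatPoly.evalZero {g δ δ' : ℕ} (p : MatPoly g δ δ') :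
    Matrix (Fin δ) (Fin δ') ℝ :=
  p.map (FreeAlgebra.lift ℝ (0 : Fin g → ℝ))

/-- The `g`-tuples of real symmetric `n × n` matrices. -/
def symmTuples (g n : ℕ) : Set (Fin g → Matrix (Fin n) (Fin n) ℝ) :=
  {X | ∀ j, (X j).IsSymm}

/-- The invertibility set of `p` in dimension `n`: the connected component of `0` in the set of
`g`-tuples `X` of symmetric `n × n` matrices for which `p(X)` is invertible. -/
def MatPoly.invertibilitySet {g δ : ℕ} (p : MatPoly g δ δ) (n : ℕ) :
    Set (Fin g → Matrix (Fin n) (Fin n) ℝ) :=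
  connectedComponentIn {X | X ∈ symmTuples g n ∧ IsUnit (p.eval X)} 0

/-- A non-commutative set `C = (C n)`, `n ≥ 1`, is bounded if one constant bounds the sum of the
operator norms `∑ ‖X_j‖` for all `X ∈ C n` and all `n ≥ 1`. -/
def NCBounded {g : ℕ} (C : (n : ℕ) → Set (Fin g → Matrix (Fin n) (Fin n) ℝ)) : Prop :=
  ∃ K : ℝ, ∀ n, 0 < n → ∀ X ∈ C n, ∑ j, ‖Matrix.toEuclideanCLM (𝕜 := ℝ) (X j)‖ ≤ K

/-- A non-commutative set `C = (C n)`, `n ≥ 1`, is convex if each `C n` is. -/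
def NCConvex {g : ℕ} (C : (n : ℕ) → Set (Fin g → Matrix (Fin n) (Fin n) ℝ)) : Prop :=
  ∀ n, 0 < n → Convex ℝ (C n)

/-- The monic affine linear pencil `I - ∑ A_j x_j`. -/
noncomputable def monicPencil {g μ : ℕ} (A : Fin g → Matrix (Fin μ) (Fin μ) ℝ) :
    MatPoly g μ μ :=
  1 - ∑ j, (A j).map fun a => a • FreeAlgebra.ι ℝ j

/-- The non-commutative set `C` equals the invertibility set of a monic affine linear pencil
`I - ∑ A_j x_j` whose coefficients `A_j` are symmetric matrices of some size `μ ≤ N`, `μ ≥ 1`. -/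
def HasLMIRepresentationOfSizeLE {g : ℕ}
    (C : (n : ℕ) → Set (Fin g → Matrix (Fin n) (Fin n) ℝ)) (N : ℕ) : Prop :=
  ∃ μ : ℕ, 0 < μ ∧ μ ≤ N ∧ ∃ A : Fin g → Matrix (Fin μ) (Fin μ) ℝ,
    (∀ j, (A j).IsSymm) ∧ ∀ n, 0 < n → C n = (monicPencil A).invertibilitySet n

end NCPoly

open Topology
set_option linter.unusedSectionVars false

namespace NCPoly

/-- The action of a row of polynomials, evaluated at `X`, on a column of vectors. -/
noncomputable def act {g δ : ℕ} {ι : Type} [Fintype ι] [DecidableEq ι]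
    (X : Fin g → Matrix ι ι ℝ) (q : Fin δ → FreeAlgebra ℝ (Fin g)) (v : Fin δ → ι → ℝ) : ι → ℝ :=
  ∑ j, FreeAlgebra.lift ℝ X (q j) *ᵥ v j

/-- `p(X)` has trivial kernel. -/
def Nonsing {g δ : ℕ} {ι : Type} [Fintype ι] [DecidableEq ι] (p : MatPoly g δ δ)
    (X : Fin g → Matrix ι ι ℝ) : Prop :=
  ∀ v, (∀ i, act X (p i) v = 0) → v = 0

/-- The tuples `X` of symmetric matrices for which `p` is invertible on the segment `[0, X]`. -/
def Dom {g δ : ℕ} {ι : Type} [Fintype ι] [DecidableEq ι] (p : MatPoly g δ δ) :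
    Set (Fin g → Matrix ι ι ℝ) :=
  {X | (∀ j, (X j).IsSymm) ∧ ∀ t ∈ Set.Icc (0 : ℝ) 1, Nonsing p (t • X)}

section act

variable {g δ : ℕ} {ι κ : Type} [Fintype ι] [DecidableEq ι] [Fintype κ] [DecidableEq κ]

lemma lift_intertwine {X : Fin g → Matrix ι ι ℝ} {Y : Fin g → Matrix κ κ ℝ} {V : Matrix ι κ ℝ}
    (h : ∀ j, X j * V = V * Y j) (q : FreeAlgebra ℝ (Fin g)) :
    FreeAlgebra.lift ℝ X q * V = V * FreeAlgebra.lift ℝ Y q := by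
  induction q using FreeAlgebra.induction with
  | grade0 r => simp [Algebra.algebraMap_eq_smul_one]
  | grade1 j => simpa using h j
  | mul a b ha hb => rw [map_mul, map_mul, Matrix.mul_assoc, hb, ← Matrix.mul_assoc, ha,
      Matrix.mul_assoc]
  | add a b ha hb => rw [map_add, map_add, Matrix.add_mul, ha, hb, Matrix.mul_add]

lemma act_intertwine {X : Fin g → Matrix ι ι ℝ} {Y : Fin g → Matrix κ κ ℝ} {V : Matrix ι κ ℝ}
    (h : ∀ j, X j * V = V * Y j) (q : Fin δ → FreeAlgebra ℝ (Fin g)) (w : Fin δ → κ → ℝ) :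
    act X q (fun j => V *ᵥ w j) = V *ᵥ act Y q w := by
  simp only [act, Matrix.mulVec_sum, Matrix.mulVec_mulVec, lift_intertwine h]

lemma act_add (X : Fin g → Matrix ι ι ℝ) (q r : Fin δ → FreeAlgebra ℝ (Fin g))
    (v : Fin δ → ι → ℝ) : act X (q + r) v = act X q v + act X r v := by
  simp [act, Matrix.add_mulVec, Finset.sum_add_distrib]

lemma act_smul (X : Fin g → Matrix ι ι ℝ) (c : ℝ) (q : Fin δ → FreeAlgebra ℝ (Fin g))
    (v : Fin δ → ι → ℝ) : act X (c • q) v = c • act X q v := by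
  simp [act, Matrix.smul_mulVec, Finset.smul_sum]

lemma act_const_mul (X : Fin g → Matrix ι ι ℝ) (a : FreeAlgebra ℝ (Fin g))
    (q : Fin δ → FreeAlgebra ℝ (Fin g)) (v : Fin δ → ι → ℝ) :
    act X (fun j => a * q j) v = FreeAlgebra.lift ℝ X a *ᵥ act X q v := by
  simp [act, Matrix.mulVec_sum, Matrix.mulVec_mulVec]

lemma act_single (X : Fin g → Matrix ι ι ℝ) (a : FreeAlgebra ℝ (Fin g)) (i : Fin δ)
    (v : Fin δ → ι → ℝ) : act X (Pi.single i a) v = FreeAlgebra.lift ℝ X a *ᵥ v i := by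
  rw [act, Finset.sum_eq_single i]
  · simp
  · intro j _ hj; simp [hj]
  · simp

lemma Nonsing.of_intertwine {p : MatPoly g δ δ} {X : Fin g → Matrix ι ι ℝ}
    {Y : Fin g → Matrix κ κ ℝ} {V : Matrix ι κ ℝ} (h : ∀ j, X j * V = V * Y j)
    (hV : ∀ w, V *ᵥ w = 0 → w = 0) (hX : Nonsing p X) : Nonsing p Y := by
  intro w hw
  have := hX (fun j => V *ᵥ w j) fun i => by rw [act_intertwine h, hw, Matrix.mulVec_zero]
  ext1 j
  exact hV _ (congrFun this j)

lemma Dom.of_intertwine {p : MatPoly g δ δ} {X : Fin g → Matrix ι ι ℝ}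
    {Y : Fin g → Matrix κ κ ℝ} {V : Matrix ι κ ℝ} (h : ∀ j, X j * V = V * Y j)
    (hV : ∀ w, V *ᵥ w = 0 → w = 0) (hY : ∀ j, (Y j).IsSymm) (hX : X ∈ Dom p) : Y ∈ Dom p :=
  ⟨hY, fun t ht => (hX.2 t ht).of_intertwine (V := V) (fun j => by simp [h]) hV⟩

lemma mulVec_eq_zero_of_isometry {V : Matrix ι κ ℝ} (hV : Vᵀ * V = 1) (w : κ → ℝ)
    (hw : V *ᵥ w = 0) : w = 0 := by
  rw [← Matrix.one_mulVec w, ← hV, ← Matrix.mulVec_mulVec, hw, Matrix.mulVec_zero]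

/-- The direct sum of two tuples of matrices. -/
def dsum (X : Fin g → Matrix ι ι ℝ) (Y : Fin g → Matrix κ κ ℝ) :
    Fin g → Matrix (ι ⊕ κ) (ι ⊕ κ) ℝ :=
  fun j => Matrix.fromBlocks (X j) 0 0 (Y j)

lemma dsum_isSymm {X : Fin g → Matrix ι ι ℝ} {Y : Fin g → Matrix κ κ ℝ}
    (hX : ∀ j, (X j).IsSymm) (hY : ∀ j, (Y j).IsSymm) (j : Fin g) : (dsum X Y j).IsSymm := by
  simp [dsum, Matrix.IsSymm, Matrix.fromBlocks_transpose, (hX j).eq, (hY j).eq]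

lemma act_dsum (X : Fin g → Matrix ι ι ℝ) (Y : Fin g → Matrix κ κ ℝ)
    (q : Fin δ → FreeAlgebra ℝ (Fin g)) (u : Fin δ → ι ⊕ κ → ℝ) :
    act (dsum X Y) q u =
      Sum.elim (act X q fun j => u j ∘ Sum.inl) (act Y q fun j => u j ∘ Sum.inr) := by
  have h1 := act_intertwine (X := X) (Y := dsum X Y) (V := Matrix.fromCols 1 0)
    (fun j => by simp [dsum, Matrix.mul_fromCols, Matrix.fromCols_mul_fromBlocks]) q u
  have h2 := act_intertwine (X := Y) (Y := dsum X Y) (V := Matrix.fromCols 0 1)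
    (fun j => by simp [dsum, Matrix.mul_fromCols, Matrix.fromCols_mul_fromBlocks]) q u
  simp only [Matrix.fromCols_mulVec, Matrix.one_mulVec, Matrix.zero_mulVec, add_zero,
    zero_add] at h1 h2
  ext (i | i)
  · rw [h1]; rfl
  · rw [h2]; rfl

lemma smul_dsum (t : ℝ) (X : Fin g → Matrix ι ι ℝ) (Y : Fin g → Matrix κ κ ℝ) :
    t • dsum X Y = dsum (t • X) (t • Y) := by
  ext1 j
  simp [dsum, Matrix.fromBlocks_smul]

lemma Nonsing.dsum {p : MatPoly g δ δ} {X : Fin g → Matrix ι ι ℝ} {Y : Fin g → Matrix κ κ ℝ}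
    (hX : Nonsing p X) (hY : Nonsing p Y) : Nonsing p (dsum X Y) := by
  intro u hu
  simp only [act_dsum] at hu
  have h1 := hX _ fun i => funext fun a => congrFun (hu i) (Sum.inl a)
  have h2 := hY _ fun i => funext fun a => congrFun (hu i) (Sum.inr a)
  ext j (a | a)
  · exact congrFun (congrFun h1 j) a
  · exact congrFun (congrFun h2 j) a

lemma Dom.dsum {p : MatPoly g δ δ} {X : Fin g → Matrix ι ι ℝ} {Y : Fin g → Matrix κ κ ℝ}
    (hX : X ∈ Dom p) (hY : Y ∈ Dom p) : dsum X Y ∈ Dom p :=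
  ⟨dsum_isSymm hX.1 hY.1, fun t ht => by
    rw [smul_dsum]; exact (hX.2 t ht).dsum (hY.2 t ht)⟩

lemma Dom.smul {p : MatPoly g δ δ} {X : Fin g → Matrix ι ι ℝ} (hX : X ∈ Dom p) {s : ℝ}
    (hs : s ∈ Set.Icc (0 : ℝ) 1) : s • X ∈ Dom p :=
  ⟨fun j => (hX.1 j).smul s, fun t ht => by
    rw [smul_smul]
    exact hX.2 _ ⟨mul_nonneg ht.1 hs.1, mul_le_one₀ ht.2 hs.1 hs.2⟩⟩

/-- A convex domain is closed under compressions. -/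
lemma Dom.compress {p : MatPoly g δ δ} (hc : Convex ℝ (Dom p : Set (Fin g → Matrix ι ι ℝ)))
    {X : Fin g → Matrix ι ι ℝ} (hX : X ∈ Dom p) {V : Matrix ι κ ℝ} (hV : Vᵀ * V = 1) :
    (fun j => Vᵀ * X j * V) ∈ Dom p := by
  set U : Matrix ι ι ℝ := (2 : ℝ) • (V * Vᵀ) - 1 with hU
  have hUt : Uᵀ = U := by simp [hU, Matrix.transpose_sub]
  have hUV : U * V = V := by
    rw [hU, Matrix.sub_mul, Matrix.smul_mul, Matrix.mul_assoc, hV, two_smul]; simp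
  have hVU : Vᵀ * U = Vᵀ := by
    rw [← hUt, ← Matrix.transpose_mul, hUV]
  have hUU : U * U = 1 := by
    nth_rw 1 [hU]
    rw [Matrix.sub_mul, Matrix.smul_mul, Matrix.mul_assoc, hVU, hU]; simp
  have hX' : (fun j => U * X j * U) ∈ Dom p := by
    refine Dom.of_intertwine (V := U) (fun j => ?_) (fun w hw => ?_) (fun j => ?_) hX
    · rw [← Matrix.mul_assoc, ← Matrix.mul_assoc, hUU, Matrix.one_mul]
    · rw [← Matrix.one_mulVec w, ← hUU, ← Matrix.mulVec_mulVec, hw, Matrix.mulVec_zero]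
    · simp [Matrix.IsSymm, Matrix.transpose_mul, hUt, (hX.1 j).eq, Matrix.mul_assoc]
  have hZ := hc hX hX' (by norm_num : (0 : ℝ) ≤ 1 / 2) (by norm_num : (0 : ℝ) ≤ 1 / 2)
    (by norm_num)
  refine Dom.of_intertwine (V := V) (fun j => ?_) (mulVec_eq_zero_of_isometry hV)
    (fun j => ?_) hZ
  · have : U * X j * U * V = (2 : ℝ) • (V * (Vᵀ * X j * V)) - X j * V := by
      rw [Matrix.mul_assoc, hUV, hU, Matrix.sub_mul, Matrix.sub_mul, Matrix.smul_mul,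
        Matrix.smul_mul]
      simp [Matrix.mul_assoc]
    simp only [Pi.add_apply, Pi.smul_apply, Matrix.add_mul, Matrix.smul_mul, this]
    module
  · simp [Matrix.IsSymm, Matrix.transpose_mul, (hX.1 j).eq, Matrix.mul_assoc]

lemma Dom.reindex {p : MatPoly g δ δ} (e : ι ≃ κ) {X : Fin g → Matrix ι ι ℝ} (hX : X ∈ Dom p) :
    (fun j => (X j).submatrix e.symm e.symm) ∈ Dom p := by
  refine Dom.of_intertwine (V := (1 : Matrix ι ι ℝ).submatrix id e.symm) (fun j => ?_)
    (fun w hw => ?_) (fun j => (hX.1 j).submatrix _) hX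
  · ext a b
    simp only [Matrix.mul_apply, Matrix.one_apply, Matrix.submatrix_apply, id, ite_mul, one_mul,
      zero_mul, mul_ite, mul_one, mul_zero, Finset.sum_ite_eq', Finset.mem_univ, if_true]
    rw [Equiv.sum_comp e.symm (fun x => if a = x then X j x (e.symm b) else 0)]
    simp
  · ext b
    have := congrFun hw (e.symm b)
    simpa [Matrix.mulVec, dotProduct, Matrix.one_apply] using this

lemma Dom.convex_of_equiv {p : MatPoly g δ δ} (e : ι ≃ κ)
    (hc : Convex ℝ (Dom p : Set (Fin g → Matrix κ κ ℝ))) :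
    Convex ℝ (Dom p : Set (Fin g → Matrix ι ι ℝ)) := by
  intro X hX Y hY a b ha hb hab
  have := Dom.reindex e.symm (hc (Dom.reindex e hX) (Dom.reindex e hY) ha hb hab)
  convert this using 1
  ext j x y
  simp

end act

end NCPoly

lemma Convex.exists_linearMap_le_of_notMem {E : Type*} [AddCommGroup E] [Module ℝ E]
    [FiniteDimensional ℝ E] {s : Set E} (hs : Convex ℝ s) (h0 : (0 : E) ∈ s) {x : E} (hx : x ∉ s) :
    ∃ f : E →ₗ[ℝ] ℝ, f ≠ 0 ∧ ∀ y ∈ s, f y ≤ f x := by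
  let e := (Module.finBasis ℝ E).equivFun
  have hs' : Convex ℝ (e '' s) := hs.linear_image e.toLinearMap
  have hx' : e x ∉ e '' s := by simpa using hx
  by_cases hi : (interior (e '' s)).Nonempty
  · obtain ⟨f, hf, h⟩ := geometric_hahn_banach_of_nonempty_interior_point hs'
      (fun h => hx' (interior_subset h)) hi
    refine ⟨f.toLinearMap ∘ₗ e.toLinearMap, fun h0 => hf ?_, fun y hy => h _ ⟨y, hy, rfl⟩⟩
    ext1 z
    simpa using LinearMap.congr_fun h0 (e.symm z)
  · rw [hs'.interior_nonempty_iff_affineSpan_eq_top] at hi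
    have h0' : (0 : Fin _ → ℝ) ∈ e '' s := ⟨0, h0, map_zero _⟩
    rw [AffineSubspace.affineSpan_eq_top_iff_vectorSpan_eq_top_of_nonempty _ _ _ ⟨_, h0'⟩,
      vectorSpan_eq_span_vsub_set_right ℝ h0'] at hi
    obtain ⟨f, hf, hk⟩ := Submodule.exists_le_ker_of_lt_top _ (lt_top_iff_ne_top.2 hi)
    have hz : ∀ y ∈ s, f (e y) = 0 := fun y hy =>
      hk (Submodule.subset_span ⟨e y, ⟨y, hy, rfl⟩, by simp⟩)
    have hne : f ∘ₗ e.toLinearMap ≠ 0 := fun h => hf <| by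
      refine LinearMap.ext fun z => ?_
      simpa using LinearMap.congr_fun h (e.symm z)
    rcases le_total 0 (f (e x)) with h | h
    · exact ⟨f ∘ₗ e.toLinearMap, hne, fun y hy => by simpa [hz y hy] using h⟩
    · exact ⟨-(f ∘ₗ e.toLinearMap), neg_ne_zero.2 hne, fun y hy => by simpa [hz y hy] using h⟩

namespace NCPoly

variable {g δ : ℕ} {ι κ : Type} [Fintype ι] [DecidableEq ι] [Fintype κ] [DecidableEq κ]

/-- The compressed convex cone, in homogeneous coordinates, generated by the domain of `p`. -/
def domCone (p : MatPoly g δ δ) (κ : Type) [Fintype κ] [DecidableEq κ] :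
    Set (Matrix κ κ ℝ × (Fin g → Matrix κ κ ℝ)) :=
  {z | ∃ (ι : Type) (_ : Fintype ι) (_ : DecidableEq ι) (V : Matrix ι κ ℝ)
    (Y : Fin g → Matrix ι ι ℝ), Y ∈ Dom p ∧ z.1 + z.1ᵀ = Vᵀ * V ∧
      ∀ j, z.2 j + (z.2 j)ᵀ = Vᵀ * Y j * V}

lemma smul_mem_domCone {p : MatPoly g δ δ} {z} (hz : z ∈ domCone p κ) {c : ℝ} (hc : 0 ≤ c) :
    c • z ∈ domCone p κ := by
  obtain ⟨ι, _, _, V, Y, hY, h1, h2⟩ := hz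
  have hcc : √c * √c = c := Real.mul_self_sqrt hc
  refine ⟨ι, _, _, √c • V, Y, hY, ?_, fun j => ?_⟩
  · simp [← smul_add, h1, smul_smul, hcc]
  · simp [← smul_add, h2, smul_smul, hcc]

lemma add_mem_domCone {p : MatPoly g δ δ} {z z'} (hz : z ∈ domCone p κ) (hz' : z' ∈ domCone p κ) :
    z + z' ∈ domCone p κ := by
  obtain ⟨ι, _, _, V, Y, hY, h1, h2⟩ := hz
  obtain ⟨ι', _, _, V', Y', hY', h1', h2'⟩ := hz'
  refine ⟨ι ⊕ ι', inferInstance, inferInstance, Matrix.fromRows V V', dsum Y Y', Dom.dsum hY hY',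
    ?_, fun j => ?_⟩
  · rw [Matrix.transpose_fromRows, Matrix.fromCols_mul_fromRows, ← h1, ← h1']
    simp only [Prod.fst_add, Matrix.transpose_add]; abel
  · rw [Matrix.transpose_fromRows, dsum, Matrix.fromCols_mul_fromBlocks,
      Matrix.fromCols_mul_fromRows, Matrix.mul_zero, Matrix.mul_zero, add_zero, zero_add,
      ← h2, ← h2']
    simp only [Prod.snd_add, Pi.add_apply, Matrix.transpose_add]; abel

lemma convex_domCone (p : MatPoly g δ δ) : Convex ℝ (domCone p κ) :=
  fun _ hx _ hy _ _ ha hb _ => add_mem_domCone (smul_mem_domCone hx ha) (smul_mem_domCone hy hb)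

/-- Convexity of the domain over every finite index type. -/
def DomConvex (p : MatPoly g δ δ) : Prop :=
  ∀ (ι : Type) [Fintype ι] [DecidableEq ι], Convex ℝ (Dom p : Set (Fin g → Matrix ι ι ℝ))

lemma mem_dom_of_mem_domCone {p : MatPoly g δ δ} (hc : DomConvex p) {X : Fin g → Matrix κ κ ℝ}
    (hX : ∀ j, (X j).IsSymm) (h : ((1 : Matrix κ κ ℝ), X) ∈ domCone p κ) : X ∈ Dom p := by
  obtain ⟨ι, _, _, V, Y, hY, h1, h2⟩ := h
  have hcc : √(1 / 2 : ℝ) * √(1 / 2 : ℝ) = 1 / 2 := Real.mul_self_sqrt (by norm_num)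
  have := Dom.compress (hc ι) hY (V := √(1 / 2 : ℝ) • V) (by
    rw [Matrix.transpose_smul, Matrix.smul_mul, Matrix.mul_smul, smul_smul, hcc, ← h1,
      Matrix.transpose_one, ← two_smul ℝ, smul_smul]
    norm_num)
  convert this using 1
  ext1 j
  rw [Matrix.transpose_smul, Matrix.smul_mul, Matrix.smul_mul, Matrix.mul_smul, smul_smul, hcc,
    ← h2, (hX j).eq, ← two_smul ℝ, smul_smul]
  norm_num

lemma _root_.Matrix.exists_eq_trace_mul (f : Matrix κ κ ℝ →ₗ[ℝ] ℝ) (hf : ∀ S, f Sᵀ = f S) :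
    ∃ T : Matrix κ κ ℝ, T.IsSymm ∧ ∀ S, f S = (T * S).trace := by
  refine ⟨Matrix.of fun a b => f (Matrix.single b a 1), ?_, fun S => ?_⟩
  · ext a b
    simp only [Matrix.transpose_apply, Matrix.of_apply]
    rw [← hf, Matrix.transpose_single]
  · have h : ∀ a b, f (Matrix.single a b (S a b)) = f (Matrix.single a b 1) * S a b := by
      intro a b
      rw [← mul_one (S a b), ← smul_eq_mul, ← Matrix.smul_single, map_smul]
      simp [mul_comm]
    conv_lhs => rw [Matrix.matrix_eq_sum_single S]
    simp only [map_sum, h]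
    rw [Finset.sum_comm]
    simp [Matrix.trace, Matrix.mul_apply]

/-- Separation of a point from the cone of the domain, by a homogeneous linear pencil. -/
lemma exists_homogeneous_pencil {p : MatPoly g δ δ} (hc : DomConvex p)
    {X : Fin g → Matrix κ κ ℝ} (hX : ∀ j, (X j).IsSymm) (hXp : X ∉ Dom p) :
    ∃ (T : Matrix κ κ ℝ) (B : Fin g → Matrix κ κ ℝ), T.IsSymm ∧ (∀ j, (B j).IsSymm) ∧
      (T = 0 → ∃ j, B j ≠ 0) ∧
      (∀ (ι : Type) [Fintype ι] [DecidableEq ι] (Y : Fin g → Matrix ι ι ℝ), Y ∈ Dom p →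
        ∀ V : Matrix ι κ ℝ, ∑ j, (B j * (Vᵀ * Y j * V)).trace ≤ (T * (Vᵀ * V)).trace) ∧
      T.trace ≤ ∑ j, (B j * X j).trace := by
  have h0 : (0 : Fin g → Matrix PEmpty PEmpty ℝ) ∈ Dom p :=
    ⟨fun j => Subsingleton.elim _ _, fun _ _ _ _ => Subsingleton.elim _ _⟩
  have hz0 : (0 : Matrix κ κ ℝ × (Fin g → Matrix κ κ ℝ)) ∈ domCone p κ :=
    ⟨PEmpty, inferInstance, inferInstance, 0, 0, h0, by simp, by simp⟩
  obtain ⟨f, hf, hle⟩ := (convex_domCone p).exists_linearMap_le_of_notMem hz0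
    fun h => hXp (mem_dom_of_mem_domCone hc hX h)
  have hx0 : 0 ≤ f (1, X) := by simpa using hle 0 hz0
  have hneg : ∀ z ∈ domCone p κ, f z ≤ 0 := by
    intro z hz
    by_contra! hlt
    have := hle _ (smul_mem_domCone hz (c := f (1, X) / f z + 1) (by positivity))
    rw [map_smul, smul_eq_mul, add_mul, div_mul_cancel₀ _ hlt.ne'] at this
    linarith
  have hanti : ∀ z : Matrix κ κ ℝ × (Fin g → Matrix κ κ ℝ), z.1 + z.1ᵀ = 0 →
      (∀ j, z.2 j + (z.2 j)ᵀ = 0) → f z = 0 := by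
    have : ∀ z : Matrix κ κ ℝ × (Fin g → Matrix κ κ ℝ), z.1 + z.1ᵀ = 0 →
      (∀ j, z.2 j + (z.2 j)ᵀ = 0) → f z ≤ 0 := fun z h1 h2 =>
      hneg z ⟨PEmpty, inferInstance, inferInstance, 0, 0, h0, by simpa using h1, by simpa using h2⟩
    intro z h1 h2
    refine le_antisymm (this z h1 h2) ?_
    have := this (-z) (by rw [Prod.fst_neg, Matrix.transpose_neg, ← neg_add, h1, neg_zero])
      (fun j => by rw [Prod.snd_neg, Pi.neg_apply, Matrix.transpose_neg, ← neg_add, h2, neg_zero])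
    simpa using this
  obtain ⟨T, hT, hfT⟩ := Matrix.exists_eq_trace_mul (-(f ∘ₗ LinearMap.inl ℝ _ _)) (fun S => by
    have := hanti (Sᵀ - S, 0) (by simp) (by simp)
    have h2 : ((Sᵀ - S, 0) : Matrix κ κ ℝ × (Fin g → Matrix κ κ ℝ)) = (Sᵀ, 0) - (S, 0) := by simp
    rw [h2, map_sub, sub_eq_zero] at this
    simpa using this)
  have hB : ∀ j, ∃ B : Matrix κ κ ℝ, B.IsSymm ∧
      ∀ S, f (0, Pi.single j S) = (B * S).trace := fun j => by
    obtain ⟨B, h1, h2⟩ := Matrix.exists_eq_trace_mul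
      (f ∘ₗ LinearMap.inr ℝ _ _ ∘ₗ LinearMap.single ℝ (fun _ => Matrix κ κ ℝ) j) (fun S => by
      have := hanti (0, Pi.single j (Sᵀ - S)) (by simp) (fun i => by
        by_cases h : i = j
        · subst h; simp
        · simp [h])
      have h2 : ((0, Pi.single j (Sᵀ - S)) : Matrix κ κ ℝ × (Fin g → Matrix κ κ ℝ)) =
        (0, Pi.single j Sᵀ) - (0, Pi.single j S) := by simp [Pi.single_sub]
      rw [h2, map_sub, sub_eq_zero] at this
      simpa using this)
    exact ⟨B, h1, fun S => by simpa using h2 S⟩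
  choose B hBs hfB using hB
  have hfz : ∀ S Z, f (S, Z) = -(T * S).trace + ∑ j, (B j * Z j).trace := by
    intro S Z
    have h1 : (S, Z) = (S, 0) + ∑ j, ((0 : Matrix κ κ ℝ), Pi.single j (Z j)) := by
      ext1
      · simp [Prod.fst_sum]
      · simp [Prod.snd_sum, Finset.univ_sum_single]
    rw [h1, map_add, map_sum]
    simp_rw [hfB, ← hfT]
    simp
  refine ⟨T, B, hT, hBs, fun hT0 => ?_, fun ι _ _ Y hY V => ?_, ?_⟩
  · by_contra! hB0
    exact hf (LinearMap.ext fun z => by rw [← Prod.mk.eta (p := z), hfz]; simp [hT0, hB0])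
  · have := hneg ((1 / 2 : ℝ) • (Vᵀ * V), fun j => (1 / 2 : ℝ) • (Vᵀ * Y j * V))
      ⟨ι, _, _, V, Y, hY, ?_, fun j => ?_⟩
    · rw [hfz] at this
      simp only [Matrix.mul_smul, Matrix.trace_smul, smul_eq_mul, ← Finset.mul_sum] at this
      linarith
    · simp only [Matrix.transpose_smul, Matrix.transpose_mul, Matrix.transpose_transpose]
      module
    · simp only [Matrix.transpose_smul, Matrix.transpose_mul, Matrix.transpose_transpose,
        (hY.1 j).eq, Matrix.mul_assoc]
      module
  · rw [hfz] at hx0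
    simpa using hx0

/-- The value of a matrix polynomial at a tuple of matrices over any finite index type. -/
noncomputable def blockEval (p : MatPoly g δ δ) (X : Fin g → Matrix ι ι ℝ) :
    Matrix (Fin δ × ι) (Fin δ × ι) ℝ :=
  Matrix.comp _ _ _ _ _ (p.map (FreeAlgebra.lift ℝ X))

lemma blockEval_mulVec (p : MatPoly g δ δ) (X : Fin g → Matrix ι ι ℝ) (u : Fin δ × ι → ℝ)
    (i : Fin δ) (a : ι) :
    (blockEval p X *ᵥ u) (i, a) = act X (p i) (fun j b => u (j, b)) a := by
  simp only [Matrix.mulVec, dotProduct, act, Fintype.sum_prod_type, Finset.sum_apply]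
  rfl

lemma isUnit_blockEval_iff {p : MatPoly g δ δ} {X : Fin g → Matrix ι ι ℝ} :
    IsUnit (blockEval p X) ↔ Nonsing p X := by
  rw [← Matrix.mulVec_injective_iff_isUnit, ← Matrix.coe_mulVecLin,
    injective_iff_map_eq_zero]
  constructor
  · intro h v hv
    have := h (fun z => v z.1 z.2) (by
      ext ⟨i, a⟩
      rw [Matrix.mulVecLin_apply, blockEval_mulVec, hv]; rfl)
    ext i a
    exact congrFun this (i, a)
  · intro h u hu
    have := h (fun j b => u (j, b)) fun i => by
      ext a
      rw [← blockEval_mulVec]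
      exact congrFun hu (i, a)
    ext ⟨i, a⟩
    exact congrFun (congrFun this i) a

lemma continuous_lift (q : FreeAlgebra ℝ (Fin g)) :
    Continuous fun X : Fin g → Matrix ι ι ℝ => FreeAlgebra.lift ℝ X q := by
  induction q using FreeAlgebra.induction with
  | grade0 r => simpa using continuous_const
  | grade1 j => simpa using continuous_apply j
  | mul a b ha hb => simp only [map_mul]; exact ha.mul hb
  | add a b ha hb => simp only [map_add]; exact ha.add hb

lemma continuous_blockEval (p : MatPoly g δ δ) :
    Continuous fun X : Fin g → Matrix ι ι ℝ => blockEval p X := by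
  refine continuous_matrix fun x y => ?_
  exact (continuous_lift (p x.1 y.1)).matrix_elem x.2 y.2

lemma isOpen_nonsing (p : MatPoly g δ δ) : IsOpen {X : Fin g → Matrix ι ι ℝ | Nonsing p X} := by
  simp_rw [← isUnit_blockEval_iff, Matrix.isUnit_iff_isUnit_det, isUnit_iff_ne_zero]
  exact isOpen_ne_fun (continuous_blockEval p).matrix_det continuous_const

lemma isOpen_nonsing_segment (p : MatPoly g δ δ) :
    IsOpen {X : Fin g → Matrix ι ι ℝ | ∀ t ∈ Set.Icc (0 : ℝ) 1, Nonsing p (t • X)} := by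
  rw [isOpen_iff_eventually]
  intro X hX
  refine isCompact_Icc.eventually_forall_of_forall_eventually fun t ht => ?_
  have hcont : Continuous fun z : (Fin g → Matrix ι ι ℝ) × ℝ => z.2 • z.1 := by fun_prop
  exact hcont.continuousAt.eventually ((isOpen_nonsing p).mem_nhds (hX t ht))

lemma lift_zero_apply (q : FreeAlgebra ℝ (Fin g)) :
    FreeAlgebra.lift ℝ (0 : Fin g → Matrix ι ι ℝ) q =
      FreeAlgebra.lift ℝ (0 : Fin g → ℝ) q • (1 : Matrix ι ι ℝ) := by
  rw [← Algebra.algebraMap_eq_smul_one, ← Algebra.ofId_apply, ← AlgHom.comp_apply]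
  congr 1
  ext1
  ext1 j
  simp

lemma act_zero (p : MatPoly g δ δ) (v : Fin δ → ι → ℝ) (i : Fin δ) (a : ι) :
    act (0 : Fin g → Matrix ι ι ℝ) (p i) v a = (p.evalZero *ᵥ fun j => v j a) i := by
  simp [act, lift_zero_apply, Matrix.smul_mulVec, Matrix.mulVec, dotProduct, MatPoly.evalZero]

lemma nonsing_zero {p : MatPoly g δ δ} (hp : IsUnit p.evalZero) :
    Nonsing p (0 : Fin g → Matrix ι ι ℝ) := by
  intro v hv
  have hinj := Matrix.mulVec_injective_iff_isUnit.2 hp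
  have : ∀ a, (fun j => v j a) = 0 := fun a => hinj (by
    ext i
    rw [← act_zero, hv, Matrix.mulVec_zero]; rfl)
  ext j a
  exact congrFun (this a) j

lemma exists_pos_smul_mem_dom {p : MatPoly g δ δ} (hp : IsUnit p.evalZero)
    {X : Fin g → Matrix ι ι ℝ} (hX : ∀ j, (X j).IsSymm) : ∃ ε : ℝ, 0 < ε ∧ ε • X ∈ Dom p := by
  have hcont : Continuous fun s : ℝ => s • X := by fun_prop
  have h := (hcont.continuousAt (x := 0)).eventually ((isOpen_nonsing_segment p).mem_nhds
    (by simp [nonsing_zero hp]))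
  obtain ⟨ε, hε, h⟩ := ((h.filter_mono nhdsWithin_le_nhds).and
    (self_mem_nhdsWithin (s := Set.Ioi (0 : ℝ)))).exists
  exact ⟨ε, h, fun j => (hX j).smul ε, hε⟩

lemma exists_one_lt_smul_mem_dom {p : MatPoly g δ δ}
    {X : Fin g → Matrix ι ι ℝ} (hX : X ∈ Dom p) : ∃ s : ℝ, 1 < s ∧ s • X ∈ Dom p := by
  have hcont : Continuous fun s : ℝ => s • X := by fun_prop
  have h := (hcont.continuousAt (x := 1)).eventually ((isOpen_nonsing_segment p).mem_nhds
    (by simp only [one_smul]; exact hX.2))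
  obtain ⟨ε, hε, h⟩ := ((h.filter_mono nhdsWithin_le_nhds).and
    (self_mem_nhdsWithin (s := Set.Ioi (1 : ℝ)))).exists
  exact ⟨ε, h, fun j => (hX.1 j).smul ε, hε⟩

/-- The quadratic form `⟨L(Y) V, V⟩` of the monic pencil `L = I - ∑ A_j x_j`, where a vector of
`ℝ^κ ⊗ ℝ^ι` is written as a matrix. -/
def pencilForm (A : Fin g → Matrix κ κ ℝ) (Y : Fin g → Matrix ι ι ℝ) (V : Matrix ι κ ℝ) : ℝ :=
  (Vᵀ * V).trace - ∑ j, (A j * (Vᵀ * Y j * V)).trace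

/-- A positive semidefinite matrix `T = Gᵀ G` with `G` partially inverted by `H`. -/
lemma _root_.Matrix.PosSemidef.exists_factor {T : Matrix κ κ ℝ} (hT : T.PosSemidef) :
    ∃ G H : Matrix κ κ ℝ, T = Gᵀ * G ∧ T * (H * G) = T ∧
      ∀ {ι : Type} [Fintype ι] (M : Matrix ι κ ℝ), (T * (H * (Mᵀ * M) * Hᵀ)).trace ≤ (Mᵀ * M).trace := by
  set U : Matrix κ κ ℝ := (hT.isHermitian.eigenvectorUnitary : Matrix κ κ ℝ) with hU
  set e := hT.isHermitian.eigenvalues with he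
  have he0 : ∀ i, 0 ≤ e i := hT.eigenvalues_nonneg
  have hUU : Uᵀ * U = 1 := by
    have := (Matrix.mem_unitaryGroup_iff').1 hT.isHermitian.eigenvectorUnitary.2
    rwa [Matrix.star_eq_conjTranspose, Matrix.conjTranspose_eq_transpose_of_trivial] at this
  have hTU : T = U * Matrix.diagonal e * Uᵀ := by
    conv_lhs => rw [hT.isHermitian.spectral_theorem, Unitary.conjStarAlgAut_apply]
    rw [Matrix.star_eq_conjTranspose, Matrix.conjTranspose_eq_transpose_of_trivial]
    rfl
  have hss : ∀ i, √(e i) * √(e i) = e i := fun i => Real.mul_self_sqrt (he0 i)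
  have hdis : ∀ i, e i * ((√(e i))⁻¹ * √(e i)) = e i := by
    intro i
    rcases (he0 i).eq_or_lt with h | h
    · simp [← h]
    · rw [inv_mul_cancel₀ (Real.sqrt_pos.2 h).ne', mul_one]
  refine ⟨Matrix.diagonal (fun i => √(e i)) * Uᵀ, U * Matrix.diagonal (fun i => (√(e i))⁻¹),
    ?_, ?_, fun {_} _ M => ?_⟩
  · calc T = U * (Matrix.diagonal (fun i => √(e i)) * Matrix.diagonal fun i => √(e i)) * Uᵀ := by
          rw [Matrix.diagonal_mul_diagonal, hTU]; simp_rw [hss]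
      _ = _ := by
          rw [Matrix.transpose_mul, Matrix.diagonal_transpose, Matrix.transpose_transpose]
          simp only [Matrix.mul_assoc]
  · rw [hTU, Matrix.mul_assoc U (Matrix.diagonal _) (_ * _), ← Matrix.mul_assoc (Matrix.diagonal _)
      (Matrix.diagonal _), Matrix.diagonal_mul_diagonal, Matrix.mul_assoc (U * _),
      ← Matrix.mul_assoc Uᵀ, hUU, Matrix.one_mul, Matrix.mul_assoc U,
      ← Matrix.mul_assoc (Matrix.diagonal _) (Matrix.diagonal _), Matrix.diagonal_mul_diagonal,
      Matrix.mul_assoc U]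
    simp_rw [hdis]
  · set D := Matrix.diagonal (fun i => (√(e i))⁻¹) with hD
    have h1 : (T * (U * D * (Mᵀ * M) * (U * D)ᵀ)).trace =
        ((D * Matrix.diagonal e * D) * (Mᵀ * M)).trace := by
      rw [hTU, ← Matrix.mul_assoc, Matrix.trace_mul_comm, Matrix.transpose_mul, hD,
        Matrix.diagonal_transpose, ← hD]
      congr 1
      calc D * Uᵀ * (U * Matrix.diagonal e * Uᵀ * (U * D * (Mᵀ * M)))
          = D * (Uᵀ * U) * Matrix.diagonal e * (Uᵀ * U) * D * (Mᵀ * M) := by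
            simp only [Matrix.mul_assoc]
        _ = _ := by simp [hUU]
    rw [h1, hD, Matrix.diagonal_mul_diagonal, Matrix.diagonal_mul_diagonal, Matrix.trace,
      Matrix.trace]
    refine Finset.sum_le_sum fun i _ => ?_
    rw [Matrix.diag_apply, Matrix.diag_apply, Matrix.diagonal_mul]
    have hp : 0 ≤ (Mᵀ * M) i i := by
      rw [Matrix.mul_apply]
      exact Finset.sum_nonneg fun x _ => mul_self_nonneg (M x i)
    refine mul_le_of_le_one_left hp ?_
    rcases (he0 i).eq_or_lt with h | h
    · simp [← h]
    · have := (Real.sqrt_pos.2 h).ne'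
      nth_rw 2 [← hss i]
      field_simp
      exact le_rfl

lemma exists_pencil {p : MatPoly g δ δ} (hp : IsUnit p.evalZero) (hc : DomConvex p)
    {X : Fin g → Matrix κ κ ℝ} (hX : ∀ j, (X j).IsSymm) (hXp : X ∉ Dom p) :
    ∃ A : Fin g → Matrix κ κ ℝ, (∀ j, (A j).IsSymm) ∧
      (∀ (ι : Type) [Fintype ι] [DecidableEq ι] (Y : Fin g → Matrix ι ι ℝ), Y ∈ Dom p →
        ∀ V : Matrix ι κ ℝ, 0 ≤ pencilForm A Y V) ∧
      ∃ W : Matrix κ κ ℝ, W ≠ 0 ∧ pencilForm A X W ≤ 0 := by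
  obtain ⟨T, B, hT, hB, hTB, hpos, hle⟩ := exists_homogeneous_pencil hc hX hXp
  have htr : ∀ (M : Matrix κ κ ℝ) (u : κ → ℝ),
      (M * Matrix.vecMulVec u u).trace = u ⬝ᵥ M *ᵥ u := by
    intro M u
    rw [Matrix.mul_vecMulVec, Matrix.trace_vecMulVec, dotProduct_comm]
  have hscal : ∀ (y : Fin g → Matrix Unit Unit ℝ), y ∈ Dom p → ∀ u : κ → ℝ,
      ∑ j, y j () () * (u ⬝ᵥ B j *ᵥ u) ≤ u ⬝ᵥ T *ᵥ u := by
    intro y hy u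
    have := hpos Unit y hy (Matrix.replicateRow Unit u)
    have e1 : (Matrix.replicateRow Unit u)ᵀ * Matrix.replicateRow Unit u =
        Matrix.vecMulVec u u := by
      ext a b; simp [Matrix.mul_apply, Matrix.vecMulVec_apply]
    have e2 : ∀ j, (Matrix.replicateRow Unit u)ᵀ * y j * Matrix.replicateRow Unit u =
        y j () () • Matrix.vecMulVec u u := by
      intro j; ext a b; simp [Matrix.mul_apply, Matrix.vecMulVec_apply]; ring
    simpa only [e1, e2, Matrix.mul_smul, Matrix.trace_smul, htr, smul_eq_mul] using this
  have hTpsd : T.PosSemidef := .of_dotProduct_mulVec_nonneg hT fun u => by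
    obtain ⟨ε, hε, h⟩ := exists_pos_smul_mem_dom (ι := Unit) (X := 0) hp (fun j => by simp)
    simpa using hscal _ h u
  have hker : ∀ j u, T *ᵥ u = 0 → B j *ᵥ u = 0 := by
    intro j u hu
    have hs : ∀ c : ℝ, ∀ i, ((Pi.single j (c • 1) : Fin g → Matrix Unit Unit ℝ) i).IsSymm :=
      fun c i => Matrix.IsSymm.ext fun _ _ => rfl
    obtain ⟨ε₁, hε₁, h₁⟩ := exists_pos_smul_mem_dom hp (hs 1)
    obtain ⟨ε₂, hε₂, h₂⟩ := exists_pos_smul_mem_dom hp (hs (-1))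
    have hq : ∀ (ε c : ℝ) (w : κ → ℝ), ∑ i, (ε • (Pi.single j (c • 1) :
        Fin g → Matrix Unit Unit ℝ)) i () () * (w ⬝ᵥ B i *ᵥ w) = ε * c * (w ⬝ᵥ B j *ᵥ w) := by
      intro ε c w
      rw [Finset.sum_eq_single j]
      · simp
      · intro i _ hi; simp [hi]
      · simp
    have g₁ := fun w => hq ε₁ 1 w ▸ hscal _ h₁ w
    have g₂ := hq ε₂ (-1) u ▸ hscal _ h₂ u
    have g₁' := g₁ u
    rw [hu, dotProduct_zero] at g₁' g₂
    have hz : u ⬝ᵥ B j *ᵥ u = 0 := by nlinarith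
    have hM : (T - ε₁ • B j).PosSemidef := .of_dotProduct_mulVec_nonneg
      (Matrix.IsHermitian.sub hT ((hB j).smul ε₁)) fun w => by
        have := g₁ w
        simp only [star_trivial, Matrix.sub_mulVec, Matrix.smul_mulVec, dotProduct_sub,
          dotProduct_smul, smul_eq_mul]
        linarith
    have := (hM.dotProduct_mulVec_zero_iff u).1 (by
      simp [Matrix.sub_mulVec, Matrix.smul_mulVec, hu, hz])
    simpa [Matrix.sub_mulVec, Matrix.smul_mulVec, hu, hε₁.ne'] using this
  obtain ⟨G, H, hGT, hTH, htrace⟩ := hTpsd.exists_factor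
  have hBH : ∀ j, B j * (H * G) = B j := by
    intro j
    have : B j * (1 - H * G) = 0 := by
      refine Matrix.ext_of_mulVec_single fun i => ?_
      rw [← Matrix.mulVec_mulVec, Matrix.zero_mulVec]
      apply hker
      rw [Matrix.mulVec_mulVec, Matrix.mul_sub, hTH, Matrix.mul_one, sub_self, Matrix.zero_mulVec]
    rw [Matrix.mul_sub, Matrix.mul_one, sub_eq_zero] at this
    exact this.symm
  refine ⟨fun j => Hᵀ * B j * H, fun j => ?_, fun ι _ _ Y hY V => ?_, Gᵀ, fun h0 => ?_, ?_⟩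
  · simp [Matrix.IsSymm, Matrix.transpose_mul, (hB j).eq, Matrix.mul_assoc]
  · have h1 := hpos ι Y hY (V * Hᵀ)
    have h2 := htrace V
    have e1 : (V * Hᵀ)ᵀ * (V * Hᵀ) = H * (Vᵀ * V) * Hᵀ := by
      simp [Matrix.transpose_mul, Matrix.mul_assoc]
    have e2 : ∀ j, (Hᵀ * B j * H * (Vᵀ * Y j * V)).trace =
        (B j * ((V * Hᵀ)ᵀ * Y j * (V * Hᵀ))).trace := by
      intro j
      rw [Matrix.mul_assoc, Matrix.mul_assoc, Matrix.trace_mul_comm]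
      simp [Matrix.transpose_mul, Matrix.mul_assoc]
    rw [e1] at h1
    simp only [pencilForm, e2]
    linarith
  · have hT0 : T = 0 := by rw [hGT, h0, Matrix.zero_mul]
    obtain ⟨j, hj⟩ := hTB hT0
    have hG : G = 0 := by simpa using congrArg Matrix.transpose h0
    exact hj (by rw [← hBH, hG]; simp)
  · have e1 : (Gᵀᵀ * Gᵀ).trace = T.trace := by
      rw [Matrix.transpose_transpose, Matrix.trace_mul_comm, hGT]
    have e2 : ∀ j, (Hᵀ * B j * H * (Gᵀᵀ * X j * Gᵀ)).trace = (B j * X j).trace := by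
      intro j
      have : Gᵀ * Hᵀ * B j = B j := by
        rw [← Matrix.transpose_mul, ← (hB j).eq, ← Matrix.transpose_mul, hBH]
      calc (Hᵀ * B j * H * (Gᵀᵀ * X j * Gᵀ)).trace
          = ((Hᵀ * B j * H * G * X j) * Gᵀ).trace := by
            simp [Matrix.mul_assoc]
        _ = (Gᵀ * Hᵀ * (B j * (H * G)) * X j).trace := by
            rw [Matrix.trace_mul_comm]; simp only [Matrix.mul_assoc]
        _ = _ := by rw [hBH, this]
    simp only [pencilForm, e1, e2]
    linarith

section degree

lemma degreeLE_mono {k l : ℕ} (h : k ≤ l) : degreeLE g k ≤ degreeLE g l :=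
  Submodule.span_mono fun _ ⟨w, hw, e⟩ => ⟨w, hw.trans h, e⟩

lemma word_mem_degreeLE {w : List (Fin g)} {k : ℕ} (hw : w.length ≤ k) :
    (w.map (FreeAlgebra.ι ℝ)).prod ∈ degreeLE g k :=
  Submodule.subset_span ⟨w, hw, rfl⟩

lemma ι_mul_mem_degreeLE (a : Fin g) {q : FreeAlgebra ℝ (Fin g)} {k : ℕ} (hq : q ∈ degreeLE g k) :
    FreeAlgebra.ι ℝ a * q ∈ degreeLE g (k + 1) := by
  induction hq using Submodule.span_induction with
  | mem x hx =>
    obtain ⟨w, hw, rfl⟩ := hx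
    exact Submodule.subset_span ⟨a :: w, by simpa using hw, by simp⟩
  | zero => simp
  | add x y _ _ hx hy => rw [mul_add]; exact add_mem hx hy
  | smul c x _ hx => rw [mul_smul_comm]; exact Submodule.smul_mem _ c hx

lemma star_word (w : List (Fin g)) :
    star (w.map (FreeAlgebra.ι ℝ)).prod = (w.reverse.map (FreeAlgebra.ι ℝ)).prod := by
  induction w with
  | nil => simp
  | cons a w ih => simp [ih]

/-- Rows of polynomials of degree at most `k`. -/
def rowLE (g δ k : ℕ) : Submodule ℝ (Fin δ → FreeAlgebra ℝ (Fin g)) :=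
  Submodule.pi Set.univ fun _ => degreeLE g k

lemma mem_rowLE {k : ℕ} {q : Fin δ → FreeAlgebra ℝ (Fin g)} :
    q ∈ rowLE g δ k ↔ ∀ j, q j ∈ degreeLE g k := by
  simp [rowLE, Submodule.mem_pi]

lemma single_mem_rowLE {k : ℕ} {a : FreeAlgebra ℝ (Fin g)} (ha : a ∈ degreeLE g k) (i : Fin δ) :
    Pi.single i a ∈ rowLE g δ k := by
  rw [mem_rowLE]
  intro j
  by_cases h : j = i
  · subst h; simpa using ha
  · simp [h]

lemma rowLE_mono {k l : ℕ} (h : k ≤ l) : rowLE g δ k ≤ rowLE g δ l := fun _ hq =>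
  mem_rowLE.2 fun j => degreeLE_mono h (mem_rowLE.1 hq j)

/-- The monomial spanning family of `rowLE`. -/
noncomputable def rowMonomial (g δ k : ℕ) (z : Fin δ × Σ j : Fin (k + 1), Fin j → Fin g) :
    Fin δ → FreeAlgebra ℝ (Fin g) :=
  Pi.single z.1 ((List.ofFn z.2.2).map (FreeAlgebra.ι ℝ)).prod

lemma rowLE_le_span (g δ k : ℕ) :
    rowLE g δ k ≤ Submodule.span ℝ (Set.range (rowMonomial g δ k)) := by
  intro q hq
  rw [← Finset.univ_sum_single q]
  refine Submodule.sum_mem _ fun i _ => ?_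
  have hqi := mem_rowLE.1 hq i
  generalize q i = a at hqi ⊢
  induction hqi using Submodule.span_induction with
  | mem x hx =>
    obtain ⟨w, hw, rfl⟩ := hx
    refine Submodule.subset_span ⟨⟨i, ⟨⟨w.length, by omega⟩, w.get⟩⟩, ?_⟩
    simp [rowMonomial]
  | zero => simp
  | add x y _ _ hx hy => rw [Pi.single_add]; exact add_mem hx hy
  | smul c x _ hx => rw [Pi.single_smul]; exact Submodule.smul_mem _ c hx

instance (k : ℕ) : FiniteDimensional ℝ (rowLE g δ k) :=
  have := FiniteDimensional.span_of_finite ℝ (Set.finite_range (rowMonomial g δ k))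
  Submodule.finiteDimensional_of_le (rowLE_le_span g δ k)

lemma finrank_rowLE_le (g δ k : ℕ) :
    Module.finrank ℝ (rowLE g δ k) ≤ δ * ∑ j ∈ Finset.range (k + 1), g ^ j := by
  have := FiniteDimensional.span_of_finite ℝ (Set.finite_range (rowMonomial g δ k))
  refine (Submodule.finrank_mono (rowLE_le_span g δ k)).trans
    ((finrank_range_le_card _).trans_eq ?_)
  simp [Fintype.card_prod, Fintype.card_sigma, Finset.sum_range]

end degree

/-- `act` as a linear map in the row of polynomials. -/
noncomputable def actHom (X : Fin g → Matrix ι ι ℝ) (v : Fin δ → ι → ℝ) :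
    (Fin δ → FreeAlgebra ℝ (Fin g)) →ₗ[ℝ] (ι → ℝ) where
  toFun q := act X q v
  map_add' q r := act_add X q r v
  map_smul' c q := act_smul X c q v

@[simp] lemma actHom_apply (X : Fin g → Matrix ι ι ℝ) (v : Fin δ → ι → ℝ) (q) :
    actHom X v q = act X q v := rfl

/-- The space of vectors `q(X) v` with `q` a row of polynomials of degree at most `k`. -/
noncomputable def reach (k : ℕ) (X : Fin g → Matrix ι ι ℝ) (v : Fin δ → ι → ℝ) :
    Submodule ℝ (ι → ℝ) :=
  (rowLE g δ k).map (actHom X v)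

lemma finrank_reach_le (k : ℕ) (X : Fin g → Matrix ι ι ℝ) (v : Fin δ → ι → ℝ) :
    Module.finrank ℝ (reach k X v) ≤ δ * ∑ j ∈ Finset.range (k + 1), g ^ j :=
  (Submodule.finrank_map_le _ _).trans (finrank_rowLE_le g δ k)

lemma mem_reach (k : ℕ) (X : Fin g → Matrix ι ι ℝ) (v : Fin δ → ι → ℝ) (j : Fin δ) :
    v j ∈ reach k X v := by
  refine ⟨Pi.single j 1, single_mem_rowLE ?_ j, ?_⟩
  · simpa using word_mem_degreeLE (g := g) (w := []) (Nat.zero_le k)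
  · simp [act_single]

section compression

variable {X : Fin g → Matrix ι ι ℝ} {v : Fin δ → ι → ℝ} {V : Matrix ι κ ℝ} {k : ℕ}

lemma transpose_mulVec_lift (hM : ∀ x ∈ reach k X v, V *ᵥ (Vᵀ *ᵥ x) = x)
    {a : FreeAlgebra ℝ (Fin g)} (ha : a ∈ degreeLE g (k + 1)) (j : Fin δ) :
    Vᵀ *ᵥ (FreeAlgebra.lift ℝ X a *ᵥ v j) =
      FreeAlgebra.lift ℝ (fun i => Vᵀ * X i * V) a *ᵥ (Vᵀ *ᵥ v j) := by
  induction ha using Submodule.span_induction with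
  | mem x hx =>
    obtain ⟨w, hw, rfl⟩ := hx
    induction w with
    | nil => simp
    | cons a w ih =>
      have hw' : w.length ≤ k := by simpa using hw
      have h1 := hM (FreeAlgebra.lift ℝ X (w.map (FreeAlgebra.ι ℝ)).prod *ᵥ v j)
        ⟨_, single_mem_rowLE (word_mem_degreeLE hw') j, by simp [act_single]⟩
      have h2 := ih (hw'.trans k.le_succ)
      rw [List.map_cons, List.prod_cons, map_mul, map_mul, ← Matrix.mulVec_mulVec,
        ← Matrix.mulVec_mulVec, ← h2, FreeAlgebra.lift_ι_apply, FreeAlgebra.lift_ι_apply,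
        ← Matrix.mulVec_mulVec, h1, Matrix.mulVec_mulVec]
  | zero => simp
  | add x y _ _ hx hy => simp only [map_add, Matrix.add_mulVec, Matrix.mulVec_add, hx, hy]
  | smul c x _ hx => simp only [map_smul, Matrix.smul_mulVec, Matrix.mulVec_smul, hx]

lemma act_compress (hM : ∀ x ∈ reach k X v, V *ᵥ (Vᵀ *ᵥ x) = x)
    {q : Fin δ → FreeAlgebra ℝ (Fin g)} (hq : q ∈ rowLE g δ k) :
    V *ᵥ act (fun i => Vᵀ * X i * V) q (fun j => Vᵀ *ᵥ v j) = act X q v := by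
  rw [← hM (act X q v) ⟨q, hq, rfl⟩]
  congr 1
  rw [act, act, Matrix.mulVec_sum]
  exact Finset.sum_congr rfl fun j _ =>
    (transpose_mulVec_lift hM (degreeLE_mono k.le_succ (mem_rowLE.1 hq j)) j).symm

lemma lift_transpose (hX : ∀ j, (X j).IsSymm) (a : FreeAlgebra ℝ (Fin g)) :
    (FreeAlgebra.lift ℝ X a)ᵀ = FreeAlgebra.lift ℝ X (star a) := by
  induction a using FreeAlgebra.induction with
  | grade0 r =>
    rw [FreeAlgebra.star_algebraMap, AlgHom.commutes, Algebra.algebraMap_eq_smul_one]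
    simp
  | grade1 j => simpa using (hX j).eq
  | mul a b ha hb => simp [ha, hb]
  | add a b ha hb => simp [ha, hb]

lemma dotProduct_lift_compress (hX : ∀ j, (X j).IsSymm)
    (hM : ∀ x ∈ reach k X v, V *ᵥ (Vᵀ *ᵥ x) = x) {d : ℕ} (hd : d ≤ 2 * k + 1)
    {a : FreeAlgebra ℝ (Fin g)} (ha : a ∈ degreeLE g d) (i j : Fin δ) :
    (Vᵀ *ᵥ v i) ⬝ᵥ FreeAlgebra.lift ℝ (fun i => Vᵀ * X i * V) a *ᵥ (Vᵀ *ᵥ v j) =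
      v i ⬝ᵥ FreeAlgebra.lift ℝ X a *ᵥ v j := by
  have hX' : ∀ j, (Vᵀ * X j * V).IsSymm := fun j => by
    simp [Matrix.IsSymm, Matrix.transpose_mul, (hX j).eq, Matrix.mul_assoc]
  induction ha using Submodule.span_induction with
  | mem x hx =>
    obtain ⟨w, hw, rfl⟩ := hx
    have hsplit : (w.map (FreeAlgebra.ι ℝ)).prod = ((w.take (k + 1)).map (FreeAlgebra.ι ℝ)).prod *
        ((w.drop (k + 1)).map (FreeAlgebra.ι ℝ)).prod := by
      rw [← List.prod_append, ← List.map_append, List.take_append_drop]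
    have h1 : star ((w.take (k + 1)).map (FreeAlgebra.ι ℝ)).prod ∈ degreeLE g (k + 1) := by
      rw [star_word]
      exact word_mem_degreeLE (by simp)
    have h2 : ((w.drop (k + 1)).map (FreeAlgebra.ι ℝ)).prod ∈ degreeLE g k :=
      word_mem_degreeLE (by simp; omega)
    set b := ((w.take (k + 1)).map (FreeAlgebra.ι ℝ)).prod
    set c := ((w.drop (k + 1)).map (FreeAlgebra.ι ℝ)).prod
    have h3 := act_compress hM (single_mem_rowLE h2 j)
    rw [act_single, act_single] at h3
    have hdot : ∀ {α : Type} [Fintype α] [DecidableEq α] (Z : Fin g → Matrix α α ℝ)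
        (_ : ∀ j, (Z j).IsSymm) (x y : α → ℝ), x ⬝ᵥ FreeAlgebra.lift ℝ Z (b * c) *ᵥ y =
        (FreeAlgebra.lift ℝ Z (star b) *ᵥ x) ⬝ᵥ (FreeAlgebra.lift ℝ Z c *ᵥ y) := by
      intro α _ _ Z hZ x y
      rw [map_mul, ← Matrix.mulVec_mulVec, Matrix.dotProduct_mulVec, ← lift_transpose hZ,
        Matrix.mulVec_transpose]
    rw [hsplit, hdot _ hX, hdot _ hX', ← h3, ← transpose_mulVec_lift hM h1,
      Matrix.dotProduct_mulVec _ V, Matrix.mulVec_transpose]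
  | zero => simp
  | add x y _ _ hx hy => simp only [map_add, Matrix.add_mulVec, dotProduct_add, hx, hy]
  | smul c x _ hx => simp only [map_smul, Matrix.smul_mulVec, dotProduct_smul, hx]

end compression

/-- A boundary point `X` of the domain together with a kernel vector `v` of `p(X)`. -/
structure IsBoundaryPair (p : MatPoly g δ δ) (X : Fin g → Matrix ι ι ℝ) (v : Fin δ → ι → ℝ) :
    Prop where
  symm : ∀ j, (X j).IsSymm
  mem : ∀ t ∈ Set.Ico (0 : ℝ) 1, t • X ∈ Dom p
  ne_zero : v ≠ 0
  act_eq : ∀ i, act X (p i) v = 0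

lemma IsBoundaryPair.dsum {p : MatPoly g δ δ} {X : Fin g → Matrix ι ι ℝ} {v : Fin δ → ι → ℝ}
    {Y : Fin g → Matrix κ κ ℝ} {w : Fin δ → κ → ℝ} (hX : IsBoundaryPair p X v)
    (hY : IsBoundaryPair p Y w) :
    IsBoundaryPair p (dsum X Y) (fun j => Sum.elim (v j) (w j)) where
  symm := dsum_isSymm hX.symm hY.symm
  mem t ht := by rw [smul_dsum]; exact Dom.dsum (hX.mem t ht) (hY.mem t ht)
  ne_zero h := hX.ne_zero (by ext j a; exact congrFun (congrFun h j) (Sum.inl a))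
  act_eq i := by
    rw [act_dsum]
    simp [hX.act_eq, hY.act_eq]

/-- Compressing a boundary pair `(X, v)` to the span of the `q(X) v`, `deg q ≤ k`, yields again a
boundary pair. -/
def CompressesBoundary (p : MatPoly g δ δ) (k : ℕ) : Prop :=
  ∀ (ι κ : Type) [Fintype ι] [DecidableEq ι] [Fintype κ] [DecidableEq κ]
    (X : Fin g → Matrix ι ι ℝ) (v : Fin δ → ι → ℝ) (V : Matrix ι κ ℝ), IsBoundaryPair p X v →
    Vᵀ * V = 1 → (∀ x ∈ reach k X v, V *ᵥ (Vᵀ *ᵥ x) = x) →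
    ∀ i, act (fun j => Vᵀ * X j * V) (p i) (fun j => Vᵀ *ᵥ v j) = 0

lemma compressesBoundary_of_degree {p : MatPoly g δ δ} {d : ℕ} (hd : p.HasDegreeLE d) :
    CompressesBoundary p d := by
  intro ι κ _ _ _ _ X v V hX hV hM i
  apply mulVec_eq_zero_of_isometry hV
  rw [act_compress hM (mem_rowLE.2 (hd i)), hX.act_eq]

lemma posSemidef_of_path {f : ℝ → Matrix ι ι ℝ} (hf : Continuous f) (hs : ∀ t, (f t).IsSymm)
    (h0 : f 0 = 1) (hu : ∀ t ∈ Set.Ico (0 : ℝ) 1, IsUnit (f t)) : (f 1).PosSemidef := by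
  set u : Set ℝ := {t | (f t).PosDef} with hu'
  have hquad : ∀ x : ι → ℝ, Continuous fun t => x ⬝ᵥ f t *ᵥ x := fun x => by fun_prop
  have hcl : closure u ⊆ {t | (f t).PosSemidef} := by
    intro t ht
    refine .of_dotProduct_mulVec_nonneg (hs t) fun x => ?_
    have : closure u ⊆ {t | 0 ≤ x ⬝ᵥ f t *ᵥ x} :=
      closure_minimal (fun s hs => by simpa using hs.posSemidef.dotProduct_mulVec_nonneg x)
        (isClosed_le continuous_const (hquad x))
    simpa using this ht
  have hopen : IsOpen u := by
    have : u = {t | ∀ x ∈ Metric.sphere (0 : ι → ℝ) 1, 0 < x ⬝ᵥ f t *ᵥ x} := by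
      ext t
      constructor
      · intro h x hx
        simpa using h.dotProduct_mulVec_pos (x := x) (by rintro rfl; simp at hx)
      · intro h
        refine .of_dotProduct_mulVec_pos (hs t) fun x hx => ?_
        have hn : 0 < ‖x‖ := norm_pos_iff.2 hx
        have := h (‖x‖⁻¹ • x) (by simp [norm_smul, hn.ne'])
        simp only [Matrix.mulVec_smul, dotProduct_smul, smul_dotProduct, smul_eq_mul] at this
        rw [star_trivial]
        have h2 : 0 < ‖x‖⁻¹ := inv_pos.2 hn
        exact pos_of_mul_pos_right (pos_of_mul_pos_right this h2.le) h2.le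
    rw [this, isOpen_iff_eventually]
    intro t ht
    refine (isCompact_sphere _ _).eventually_forall_of_forall_eventually fun x hx => ?_
    have hcont : Continuous fun z : ℝ × (ι → ℝ) => z.2 ⬝ᵥ f z.1 *ᵥ z.2 := by fun_prop
    exact hcont.continuousAt.eventually (lt_mem_nhds (ht x hx))
  have hsub : Set.Ico (0 : ℝ) 1 ⊆ u := by
    refine isPreconnected_Ico.subset_of_closure_inter_subset hopen
      ⟨0, by simp, by simp [hu', h0, Matrix.PosDef.one]⟩ fun t ht => ?_
    exact (hcl ht.1).posDef_iff_isUnit.2 (hu t ht.2)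
  apply hcl
  apply closure_mono hsub
  rw [closure_Ico (by norm_num)]
  simp

lemma blockEval_isSymm {p : MatPoly g δ δ} (hp : p.IsSymmetric) {X : Fin g → Matrix ι ι ℝ}
    (hX : ∀ j, (X j).IsSymm) : (blockEval p X).IsSymm := by
  ext ⟨i, a⟩ ⟨j, b⟩
  have h := congrFun (congrFun hp i) j
  rw [Matrix.conjTranspose_apply] at h
  change FreeAlgebra.lift ℝ X (p j i) b a = FreeAlgebra.lift ℝ X (p i j) a b
  rw [← h, ← lift_transpose hX]
  rfl

lemma blockEval_zero {p : MatPoly g δ δ} (hp : p.evalZero = 1) :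
    blockEval p (0 : Fin g → Matrix ι ι ℝ) = 1 := by
  ext ⟨i, a⟩ ⟨j, b⟩
  change FreeAlgebra.lift ℝ (0 : Fin g → Matrix ι ι ℝ) (p i j) a b = _
  have h := congrFun (congrFun hp i) j
  rw [lift_zero_apply]
  change FreeAlgebra.lift ℝ (0 : Fin g → ℝ) (p i j) = _ at h
  rw [h]
  by_cases h1 : i = j <;> by_cases h2 : a = b <;> simp [Matrix.one_apply, h1, h2]

lemma compressesBoundary_of_half_degree {p : MatPoly g δ δ} {d k : ℕ} (hd : p.HasDegreeLE d)
    (hk : d ≤ 2 * k + 1) (hp : p.IsSymmetric) (h1 : p.evalZero = 1) (hc : DomConvex p) :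
    CompressesBoundary p k := by
  intro ι κ _ _ _ _ X v V hX hV hM i
  set X' : Fin g → Matrix κ κ ℝ := fun j => Vᵀ * X j * V with hX'
  have hX's : ∀ j, (X' j).IsSymm := fun j => by
    simp [hX', Matrix.IsSymm, Matrix.transpose_mul, (hX.symm j).eq, Matrix.mul_assoc]
  have hdom : ∀ t ∈ Set.Ico (0 : ℝ) 1, t • X' ∈ Dom p := fun t ht => by
    convert Dom.compress (hc ι) (hX.mem t ht) hV using 1
    ext1 j
    simp [hX']
  have hpsd : (blockEval p X').PosSemidef := by
    have := posSemidef_of_path (f := fun t : ℝ => blockEval p (t • X'))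
      ((continuous_blockEval p).comp (by fun_prop))
      (fun t => blockEval_isSymm hp fun j => (hX's j).smul t)
      (by simpa using blockEval_zero h1)
      (fun t ht => isUnit_blockEval_iff.2 (by simpa using (hdom t ht).2 1 (by simp)))
    simpa using this
  set u : Fin δ × κ → ℝ := fun z => (Vᵀ *ᵥ v z.1) z.2
  have hform : u ⬝ᵥ blockEval p X' *ᵥ u = 0 := by
    have e : u ⬝ᵥ blockEval p X' *ᵥ u =
        ∑ i, (Vᵀ *ᵥ v i) ⬝ᵥ act X' (p i) (fun j => Vᵀ *ᵥ v j) := by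
      simp only [dotProduct, Fintype.sum_prod_type, blockEval_mulVec, u]
    have e2 : ∀ i, (Vᵀ *ᵥ v i) ⬝ᵥ act X' (p i) (fun j => Vᵀ *ᵥ v j) =
        v i ⬝ᵥ act X (p i) v := fun i => by
      rw [act, act, dotProduct_sum, dotProduct_sum]
      exact Finset.sum_congr rfl fun j _ => dotProduct_lift_compress hX.symm hM hk (hd i j) i j
    rw [e, Finset.sum_eq_zero fun i _ => by rw [e2, hX.act_eq, dotProduct_zero]]
  have := (hpsd.dotProduct_mulVec_zero_iff u).1 (by simpa using hform)
  ext a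
  rw [← blockEval_mulVec p X' u, this]
  rfl

/-- The operator `L(Y)` of the monic pencil `L = I - ∑ A_j x_j`, acting on matrices. -/
def pencilOp (A : Fin g → Matrix κ κ ℝ) (Y : Fin g → Matrix ι ι ℝ) (V : Matrix ι κ ℝ) :
    Matrix ι κ ℝ :=
  V - ∑ j, Y j * V * A j

lemma pencilForm_eq (A : Fin g → Matrix κ κ ℝ) (Y : Fin g → Matrix ι ι ℝ) (V : Matrix ι κ ℝ) :
    pencilForm A Y V = (Vᵀ * pencilOp A Y V).trace := by
  rw [pencilForm, pencilOp, Matrix.mul_sub, Matrix.trace_sub, Matrix.mul_sum, Matrix.trace_sum]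
  congr 1
  refine Finset.sum_congr rfl fun j _ => ?_
  rw [Matrix.trace_mul_comm]
  simp only [Matrix.mul_assoc]

lemma trace_pencilOp_comm {A : Fin g → Matrix κ κ ℝ} (hA : ∀ j, (A j).IsSymm)
    {Y : Fin g → Matrix ι ι ℝ} (hY : ∀ j, (Y j).IsSymm) (U V : Matrix ι κ ℝ) :
    (Uᵀ * pencilOp A Y V).trace = (Vᵀ * pencilOp A Y U).trace := by
  rw [← Matrix.trace_transpose, Matrix.transpose_mul, Matrix.transpose_transpose, pencilOp,
    pencilOp, Matrix.transpose_sub, Matrix.sub_mul, Matrix.mul_sub, Matrix.trace_sub,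
    Matrix.trace_sub, Matrix.transpose_sum, Matrix.sum_mul, Matrix.mul_sum, Matrix.trace_sum,
    Matrix.trace_sum]
  congr 1
  refine Finset.sum_congr rfl fun j _ => ?_
  rw [Matrix.transpose_mul, Matrix.transpose_mul, (hA j).eq, (hY j).eq, Matrix.mul_assoc,
    Matrix.trace_mul_comm]
  simp only [Matrix.mul_assoc]

lemma pencilOp_add_smul (A : Fin g → Matrix κ κ ℝ) (Y : Fin g → Matrix ι ι ℝ)
    (U V : Matrix ι κ ℝ) (t : ℝ) :
    pencilOp A Y (U + t • V) = pencilOp A Y U + t • pencilOp A Y V := by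
  simp only [pencilOp, Matrix.mul_add, Matrix.add_mul, Finset.sum_add_distrib, Matrix.mul_smul,
    Matrix.smul_mul, ← Finset.smul_sum, smul_sub]
  abel

lemma trace_transpose_mul_self_nonneg (V : Matrix ι κ ℝ) : 0 ≤ (Vᵀ * V).trace := by
  have := (Matrix.posSemidef_conjTranspose_mul_self V).trace_nonneg
  rwa [Matrix.conjTranspose_eq_transpose_of_trivial] at this

lemma eq_zero_of_trace_transpose_mul_self {V : Matrix ι κ ℝ} (h : (Vᵀ * V).trace = 0) :
    V = 0 := by
  rw [← Matrix.conjTranspose_eq_transpose_of_trivial] at h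
  exact Matrix.trace_conjTranspose_mul_self_eq_zero_iff.1 h

lemma pencilOp_eq_zero {A : Fin g → Matrix κ κ ℝ} (hA : ∀ j, (A j).IsSymm)
    {Y : Fin g → Matrix ι ι ℝ} (hY : ∀ j, (Y j).IsSymm)
    (hpos : ∀ V : Matrix ι κ ℝ, 0 ≤ pencilForm A Y V) {Z : Matrix ι κ ℝ}
    (hZ : pencilForm A Y Z ≤ 0) : pencilOp A Y Z = 0 := by
  set N := pencilOp A Y Z with hN
  set n := (Nᵀ * N).trace with hn
  set m := pencilForm A Y N with hm
  have hm0 : 0 ≤ m := hpos N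
  have key : ∀ t : ℝ, 0 ≤ 2 * t * n + t ^ 2 * m := by
    intro t
    have h := hpos (Z + t • N)
    have hz : pencilForm A Y Z = 0 := le_antisymm hZ (hpos Z)
    have hc := trace_pencilOp_comm hA hY Z N
    rw [pencilForm_eq] at h hz hm
    rw [pencilOp_add_smul, Matrix.transpose_add, Matrix.add_mul, Matrix.mul_add, Matrix.mul_add,
      Matrix.transpose_smul, Matrix.smul_mul, Matrix.smul_mul, Matrix.mul_smul, Matrix.mul_smul,
      Matrix.trace_add, Matrix.trace_add, Matrix.trace_add, Matrix.trace_smul, Matrix.trace_smul,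
      Matrix.trace_smul, Matrix.trace_smul, hz, hc, ← hN, ← hn, ← hm] at h
    simp only [smul_eq_mul] at h
    linarith
  apply eq_zero_of_trace_transpose_mul_self
  have hn0 : 0 ≤ n := trace_transpose_mul_self_nonneg N
  by_contra hne
  have hn1 : 0 < n := lt_of_le_of_ne hn0 (Ne.symm hne)
  have h := key (-n / (m + 1))
  have e : 2 * (-n / (m + 1)) * n + (-n / (m + 1)) ^ 2 * m =
      -(n ^ 2 * (m + 2)) / (m + 1) ^ 2 := by
    field_simp; ring
  rw [e] at h
  have : 0 < n ^ 2 * (m + 2) / (m + 1) ^ 2 := by positivity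
  rw [neg_div] at h
  linarith

lemma pencilForm_smul (A : Fin g → Matrix κ κ ℝ) (Y : Fin g → Matrix ι ι ℝ) (V : Matrix ι κ ℝ)
    (t : ℝ) : pencilForm A (t • Y) V =
      (Vᵀ * V).trace - t * ∑ j, (A j * (Vᵀ * Y j * V)).trace := by
  simp [pencilForm, Finset.mul_sum]

lemma pencilForm_nonneg_of_ray {A : Fin g → Matrix κ κ ℝ} {Y : Fin g → Matrix ι ι ℝ}
    {V : Matrix ι κ ℝ} (h : ∀ t ∈ Set.Ico (0 : ℝ) 1, 0 ≤ pencilForm A (t • Y) V) :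
    0 ≤ pencilForm A Y V := by
  have h1 := pencilForm_smul A Y V 1
  rw [one_smul, one_mul] at h1
  simp only [pencilForm_smul] at h
  have ha := trace_transpose_mul_self_nonneg V
  set a := (Vᵀ * V).trace
  set b := ∑ j, (A j * (Vᵀ * Y j * V)).trace
  rw [h1]
  by_contra! hlt
  have hb : 0 < b := by linarith
  have := h ((a + b) / (2 * b)) ⟨by positivity, by rw [div_lt_one (by positivity)]; linarith⟩
  have e : (a + b) / (2 * b) * b = (a + b) / 2 := by field_simp
  rw [e] at this
  linarith

lemma pencilForm_isometry (A : Fin g → Matrix κ κ ℝ) (X : Fin g → Matrix ι ι ℝ)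
    {ξ : Type} [Fintype ξ] [DecidableEq ξ] {V : Matrix ι ξ ℝ} (hV : Vᵀ * V = 1)
    (W : Matrix ξ κ ℝ) :
    pencilForm A X (V * W) = pencilForm A (fun j => Vᵀ * X j * V) W := by
  have : (V * W)ᵀ * (V * W) = Wᵀ * W := by
    rw [Matrix.transpose_mul, Matrix.mul_assoc, ← Matrix.mul_assoc Vᵀ, hV, Matrix.one_mul]
  rw [pencilForm, this, pencilForm]
  simp only [Matrix.transpose_mul, Matrix.mul_assoc]

/-- The pencil is positive semidefinite on the domain of `p`. -/
def PencilNonneg (p : MatPoly g δ δ) (A : Fin g → Matrix κ κ ℝ) : Prop :=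
  ∀ (ι : Type) [Fintype ι] [DecidableEq ι] (Y : Fin g → Matrix ι ι ℝ), Y ∈ Dom p →
    ∀ V : Matrix ι κ ℝ, 0 ≤ pencilForm A Y V

/-- Every subspace of `ℝ^ι` is the range of an isometry. -/
lemma exists_isometry (M : Submodule ℝ (ι → ℝ)) :
    ∃ V : Matrix ι (Fin (Module.finrank ℝ M)) ℝ, Vᵀ * V = 1 ∧
      (∀ x ∈ M, V *ᵥ (Vᵀ *ᵥ x) = x) ∧ ∀ a, V.col a ∈ M := by
  let e := (WithLp.linearEquiv 2 ℝ (ι → ℝ)).symm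
  let M' : Submodule ℝ (EuclideanSpace ℝ ι) := M.map e.toLinearMap
  have hfr : Module.finrank ℝ M' = Module.finrank ℝ M := LinearEquiv.finrank_map_eq e M
  let b := (stdOrthonormalBasis ℝ M').reindex (finCongr hfr)
  refine ⟨Matrix.of fun i a => (b a : EuclideanSpace ℝ ι) i, ?_, fun x hx => ?_, fun a => ?_⟩
  · ext a c
    have := orthonormal_iff_ite.1 b.orthonormal c a
    rw [Submodule.coe_inner, PiLp.inner_apply] at this
    rw [Matrix.mul_apply, Matrix.one_apply]
    simp only [RCLike.inner_apply, conj_trivial] at this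
    simp only [Matrix.transpose_apply, Matrix.of_apply, this, eq_comm]
  · have := b.sum_repr' ⟨e x, ⟨x, hx, rfl⟩⟩
    have h2 := congrArg (fun z : M' => (z : EuclideanSpace ℝ ι)) this
    ext i
    have h3 := congrArg (fun z : EuclideanSpace ℝ ι => z i) h2
    simp only [Submodule.coe_sum, Submodule.coe_smul, Submodule.coe_inner, PiLp.inner_apply] at h3
    simp only [WithLp.ofLp_sum, Finset.sum_apply, WithLp.ofLp_smul, Pi.smul_apply,
      RCLike.inner_apply, conj_trivial, smul_eq_mul] at h3
    simp only [Matrix.mulVec, dotProduct, Matrix.transpose_apply, Matrix.of_apply]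
    refine Eq.trans (Finset.sum_congr rfl fun a _ => ?_) h3
    rw [mul_comm]
    congr 1
    exact Finset.sum_congr rfl fun j _ => mul_comm _ _
  · obtain ⟨x, hx, hxe⟩ := (b a).2
    have : Matrix.col (Matrix.of fun i a => (b a : EuclideanSpace ℝ ι) i) a = x := by
      ext i
      change (b a : EuclideanSpace ℝ ι) i = x i
      rw [← hxe]; rfl
    rwa [this]

/-- A boundary pair carries a pencil, of the size of its reach, which is singular there. -/
lemma IsBoundaryPair.exists_pencil {p : MatPoly g δ δ} (hp : IsUnit p.evalZero)
    (hc : DomConvex p) {k : ℕ} (hk : CompressesBoundary p k) {X : Fin g → Matrix ι ι ℝ}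
    {v : Fin δ → ι → ℝ} (hX : IsBoundaryPair p X v) :
    ∃ A : Fin g → Matrix (Fin (Module.finrank ℝ (reach k X v)))
        (Fin (Module.finrank ℝ (reach k X v))) ℝ, (∀ j, (A j).IsSymm) ∧ PencilNonneg p A ∧
      ∃ q : Fin (Module.finrank ℝ (reach k X v)) → Fin δ → FreeAlgebra ℝ (Fin g),
        (∀ a, q a ∈ rowLE g δ k) ∧ (∃ a, act X (q a) v ≠ 0) ∧
        pencilOp A X (Matrix.of fun i a => act X (q a) v i) = 0 := by
  obtain ⟨V, hV, hVM, hcol⟩ := exists_isometry (reach k X v)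
  have hv' : (fun j => Vᵀ *ᵥ v j) ≠ 0 := fun h => hX.ne_zero <| by
    ext1 j
    rw [← hVM (v j) (mem_reach k X v j), congrFun h j]
    simp
  have hX's : ∀ j, (Vᵀ * X j * V).IsSymm := fun j => by
    simp [Matrix.IsSymm, Matrix.transpose_mul, (hX.symm j).eq, Matrix.mul_assoc]
  have hnot : (fun j => Vᵀ * X j * V) ∉ Dom p := fun h =>
    hv' ((by simpa using h.2 1 (by simp) : Nonsing p _) _ (hk _ _ X v V hX hV hVM))
  obtain ⟨A, hA, hpos, W, hW, hWle⟩ := NCPoly.exists_pencil hp hc hX's hnot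
  refine ⟨A, hA, hpos, ?_⟩
  have hposX : ∀ U : Matrix ι _ ℝ, 0 ≤ pencilForm A X U := fun U =>
    pencilForm_nonneg_of_ray fun t ht => hpos ι _ (hX.mem t ht) U
  have hmem : ∀ a, (V * W).col a ∈ reach k X v := by
    intro a
    have : (V * W).col a = ∑ b, W b a • V.col b := by
      ext i
      simp [Matrix.mul_apply, mul_comm]
    rw [this]
    exact Submodule.sum_mem _ fun b _ => Submodule.smul_mem _ _ (hcol b)
  choose q hq hqa using hmem
  have hZ : (Matrix.of fun i a => act X (q a) v i) = V * W := by
    ext i a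
    exact congrFun (hqa a) i
  refine ⟨q, hq, ?_, ?_⟩
  · by_contra! h0
    apply hW
    rw [← Matrix.one_mul W, ← hV, Matrix.mul_assoc, ← hZ]
    simp only [h0]
    ext; simp [Matrix.mul_apply]
  · rw [hZ]
    exact pencilOp_eq_zero hA hX.symm hposX (by rwa [pencilForm_isometry A X hV])

/-- The rows of the matrix polynomial `L q`, for a monic pencil `L`. -/
noncomputable def pencilRow (A : Fin g → Matrix κ κ ℝ) (q : κ → Fin δ → FreeAlgebra ℝ (Fin g))
    (a : κ) : Fin δ → FreeAlgebra ℝ (Fin g) :=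
  q a + ∑ j, ∑ b, (-(A j b a)) • fun i => FreeAlgebra.ι ℝ j * q b i

lemma pencilRow_mem (A : Fin g → Matrix κ κ ℝ) {q : κ → Fin δ → FreeAlgebra ℝ (Fin g)} {k : ℕ}
    (hq : ∀ a, q a ∈ rowLE g δ k) (a : κ) : pencilRow A q a ∈ rowLE g δ (k + 1) := by
  refine add_mem (rowLE_mono k.le_succ (hq a)) (Submodule.sum_mem _ fun j _ =>
    Submodule.sum_mem _ fun b _ => Submodule.smul_mem _ _ (mem_rowLE.2 fun i => ?_))
  exact ι_mul_mem_degreeLE j (mem_rowLE.1 (hq b) i)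

lemma act_pencilRow (A : Fin g → Matrix κ κ ℝ) (q : κ → Fin δ → FreeAlgebra ℝ (Fin g))
    (X : Fin g → Matrix ι ι ℝ) (v : Fin δ → ι → ℝ) (i : ι) (a : κ) :
    act X (pencilRow A q a) v i = pencilOp A X (Matrix.of fun i a => act X (q a) v i) i a := by
  rw [← actHom_apply, pencilRow, map_add, map_sum]
  simp only [map_sum, map_smul, actHom_apply, act_const_mul, FreeAlgebra.lift_ι_apply]
  simp only [pencilOp, Pi.add_apply, Finset.sum_apply, Pi.smul_apply, Matrix.sub_apply,
    Matrix.sum_apply, Matrix.of_apply, sub_eq_add_neg, ← Finset.sum_neg_distrib]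
  congr 1
  refine Finset.sum_congr rfl fun j _ => ?_
  rw [Matrix.mul_apply, ← Finset.sum_neg_distrib]
  refine Finset.sum_congr rfl fun b _ => ?_
  simp [Matrix.mul_apply, Matrix.mulVec, dotProduct, mul_comm]

lemma _root_.Submodule.map_injOn_of_finrank_le {E F : Type*} [AddCommGroup E] [Module ℝ E]
    [AddCommGroup F] [Module ℝ F] (N : Submodule ℝ E) [FiniteDimensional ℝ N] (π : E →ₗ[ℝ] F)
    (h : Module.finrank ℝ N ≤ Module.finrank ℝ (N.map π)) {x : E} (hx : x ∈ N) (h0 : π x = 0) :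
    x = 0 := by
  have h1 := LinearMap.finrank_range_add_finrank_ker (π.domRestrict N)
  rw [LinearMap.range_domRestrict] at h1
  have h2 : Module.finrank ℝ (LinearMap.ker (π.domRestrict N)) = 0 := by omega
  rw [Submodule.finrank_eq_zero] at h2
  have : (⟨x, hx⟩ : N) ∈ LinearMap.ker (π.domRestrict N) := h0
  rw [h2, Submodule.mem_bot] at this
  exact congrArg Subtype.val this

lemma _root_.Submodule.finrank_map_lt_finrank_map {E F F' : Type*} [AddCommGroup E] [Module ℝ E]
    [AddCommGroup F] [Module ℝ F] [AddCommGroup F'] [Module ℝ F'] (N : Submodule ℝ E)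
    [FiniteDimensional ℝ N] (f : E →ₗ[ℝ] F) (f' : E →ₗ[ℝ] F')
    (h : ∀ x ∈ N, f x = 0 → f' x = 0) {x : E} (hx : x ∈ N) (h1 : f x ≠ 0) (h2 : f' x = 0) :
    Module.finrank ℝ (N.map f') < Module.finrank ℝ (N.map f) := by
  have e1 := LinearMap.finrank_range_add_finrank_ker (f.domRestrict N)
  have e2 := LinearMap.finrank_range_add_finrank_ker (f'.domRestrict N)
  rw [LinearMap.range_domRestrict] at e1 e2
  have hlt : LinearMap.ker (f.domRestrict N) < LinearMap.ker (f'.domRestrict N) := by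
    refine lt_of_le_of_ne (fun y hy => h _ y.2 hy) fun he => h1 ?_
    have : (⟨x, hx⟩ : N) ∈ LinearMap.ker (f'.domRestrict N) := h2
    rw [← he] at this
    exact this
  have := Submodule.finrank_lt_finrank_of_lt hlt
  omega

/-- If the reach of `(X, v)` does not grow under a direct sum with `(Y, w)`, then the rows killing
`(X, v)` kill `(Y, w)`. -/
lemma act_eq_zero_of_finrank_reach_dsum_le {k : ℕ} {X : Fin g → Matrix ι ι ℝ} {v : Fin δ → ι → ℝ}
    {Y : Fin g → Matrix κ κ ℝ} {w : Fin δ → κ → ℝ}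
    (h : Module.finrank ℝ (reach k (dsum X Y) fun j => Sum.elim (v j) (w j)) ≤
      Module.finrank ℝ (reach k X v))
    {q : Fin δ → FreeAlgebra ℝ (Fin g)} (hq : q ∈ rowLE g δ k) (h0 : act X q v = 0) :
    act Y q w = 0 := by
  let π : (ι ⊕ κ → ℝ) →ₗ[ℝ] (ι → ℝ) := LinearMap.funLeft ℝ ℝ Sum.inl
  have hact : ∀ q : Fin δ → FreeAlgebra ℝ (Fin g),
      act (dsum X Y) q (fun j => Sum.elim (v j) (w j)) = Sum.elim (act X q v) (act Y q w) :=
    fun q => by rw [act_dsum]; rfl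
  have hmap : (reach k (dsum X Y) fun j => Sum.elim (v j) (w j)).map π = reach k X v := by
    rw [reach, reach, ← Submodule.map_comp]
    congr 1
    refine LinearMap.ext fun q => ?_
    rw [LinearMap.comp_apply, actHom_apply, hact]
    rfl
  rw [← hmap] at h
  have h1 := Submodule.map_injOn_of_finrank_le _ π h (x := act (dsum X Y) q _) ⟨q, hq, rfl⟩
    (by rw [hact]; exact h0)
  rw [hact] at h1
  ext a
  exact congrFun h1 (Sum.inr a)

lemma pencilOp_dsum {ξ : Type} [Fintype ξ] [DecidableEq ξ] (A : Fin g → Matrix κ κ ℝ)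
    (B : Fin g → Matrix ξ ξ ℝ) (Y : Fin g → Matrix ι ι ℝ) (U : Matrix ι κ ℝ) (V : Matrix ι ξ ℝ) :
    pencilOp (dsum A B) Y (Matrix.fromCols U V) =
      Matrix.fromCols (pencilOp A Y U) (pencilOp B Y V) := by
  have : ∀ j, Y j * Matrix.fromCols U V * dsum A B j =
      Matrix.fromCols (Y j * U * A j) (Y j * V * B j) := fun j => by
    simp [dsum, Matrix.mul_fromCols, Matrix.fromCols_mul_fromBlocks]
  simp only [pencilOp, this]
  ext i (a | a) <;> simp [Matrix.sum_apply]

lemma PencilNonneg.dsum {ξ : Type} [Fintype ξ] [DecidableEq ξ] {p : MatPoly g δ δ}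
    {A : Fin g → Matrix κ κ ℝ} {B : Fin g → Matrix ξ ξ ℝ} (hA : PencilNonneg p A)
    (hB : PencilNonneg p B) : PencilNonneg p (dsum A B) := by
  intro ι _ _ Y hY V
  rw [← Matrix.fromCols_toCols V, pencilForm_eq, pencilOp_dsum, Matrix.transpose_fromCols,
    Matrix.fromRows_mul_fromCols, Matrix.trace, Fintype.sum_sum_type]
  simp only [Matrix.diag_apply, Matrix.fromBlocks_apply₁₁, Matrix.fromBlocks_apply₂₂]
  have hA' := hA ι Y hY V.toCols₁
  have hB' := hB ι Y hY V.toCols₂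
  rw [pencilForm_eq] at hA' hB'
  exact add_nonneg hA' hB'

/-- The pencil `A` is singular at every boundary pair killed by the rows in `Q`. -/
def PencilSingularOn (p : MatPoly g δ δ) (Q : Set (Fin δ → FreeAlgebra ℝ (Fin g)))
    (A : Fin g → Matrix κ κ ℝ) : Prop :=
  ∀ (ι : Type) [Fintype ι] [DecidableEq ι] (Y : Fin g → Matrix ι ι ℝ) (w : Fin δ → ι → ℝ),
    IsBoundaryPair p Y w → (∀ q ∈ Q, act Y q w = 0) →
    ∃ Z : Matrix ι κ ℝ, Z ≠ 0 ∧ pencilOp A Y Z = 0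

lemma finrank_reach_pos {p : MatPoly g δ δ} {k : ℕ} {X : Fin g → Matrix ι ι ℝ}
    {v : Fin δ → ι → ℝ} (h : IsBoundaryPair p X v) : 0 < Module.finrank ℝ (reach k X v) := by
  rw [Module.finrank_pos_iff, Submodule.nontrivial_iff_ne_bot]
  intro hb
  apply h.ne_zero
  ext1 j
  have := mem_reach k X v j
  rwa [hb, Submodule.mem_bot] at this

/-- Among the boundary pairs killed by `Q` there is a dominating one. -/
lemma exists_dominating {p : MatPoly g δ δ} (k : ℕ) {Q : Set (Fin δ → FreeAlgebra ℝ (Fin g))}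
    {X : Fin g → Matrix ι ι ℝ} {v : Fin δ → ι → ℝ} (hX : IsBoundaryPair p X v)
    (hQ : ∀ q ∈ Q, act X q v = 0) :
    ∃ (ι : Type) (_ : Fintype ι) (_ : DecidableEq ι) (X : Fin g → Matrix ι ι ℝ)
      (v : Fin δ → ι → ℝ), IsBoundaryPair p X v ∧ (∀ q ∈ Q, act X q v = 0) ∧
      ∀ (κ : Type) [Fintype κ] [DecidableEq κ] (Y : Fin g → Matrix κ κ ℝ) (w : Fin δ → κ → ℝ),
        IsBoundaryPair p Y w → (∀ q ∈ Q, act Y q w = 0) →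
        ∀ q ∈ rowLE g δ k, act X q v = 0 → act Y q w = 0 := by
  let S : Set ℕ := {n | ∃ (ι : Type) (_ : Fintype ι) (_ : DecidableEq ι)
    (X : Fin g → Matrix ι ι ℝ) (v : Fin δ → ι → ℝ), IsBoundaryPair p X v ∧
      (∀ q ∈ Q, act X q v = 0) ∧ Module.finrank ℝ (reach k X v) = n}
  have hb : BddAbove S := by
    refine ⟨δ * ∑ j ∈ Finset.range (k + 1), g ^ j, ?_⟩
    rintro n ⟨ι, _, _, X, v, -, -, rfl⟩
    exact finrank_reach_le k X v
  obtain ⟨ι', _, _, X', v', h1, h2, h3⟩ := Nat.sSup_mem (s := S) ⟨_, ι, _, _, X, v, hX, hQ, rfl⟩ hb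
  refine ⟨ι', _, _, X', v', h1, h2, fun κ _ _ Y w hY hYQ q hq h0 => ?_⟩
  refine act_eq_zero_of_finrank_reach_dsum_le ?_ hq h0
  rw [h3]
  refine le_csSup hb ⟨ι' ⊕ κ, inferInstance, inferInstance, _, _, h1.dsum hY, fun r hr => ?_, rfl⟩
  rw [act_dsum]
  ext (a | a)
  · exact congrFun (h2 r hr) a
  · exact congrFun (hYQ r hr) a

lemma exists_pencil_of_finrank_reach_le {p : MatPoly g δ δ} (hp : IsUnit p.evalZero)
    (hc : DomConvex p) {k : ℕ} (hk : CompressesBoundary p k) (r : ℕ) :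
    ∀ Q : Set (Fin δ → FreeAlgebra ℝ (Fin g)),
      (∀ (ι : Type) [Fintype ι] [DecidableEq ι] (X : Fin g → Matrix ι ι ℝ) (v : Fin δ → ι → ℝ),
        IsBoundaryPair p X v → (∀ q ∈ Q, act X q v = 0) →
        Module.finrank ℝ (reach k X v) ≤ r) →
      ∃ (κ : Type) (_ : Fintype κ) (_ : DecidableEq κ) (A : Fin g → Matrix κ κ ℝ),
        Fintype.card κ * 2 ≤ r * (r + 1) ∧ (∀ j, (A j).IsSymm) ∧ PencilNonneg p A ∧
        PencilSingularOn p Q A := by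
  have hempty : PencilNonneg p (0 : Fin g → Matrix Empty Empty ℝ) := fun ι _ _ Y _ V => by
    simp [pencilForm, Matrix.trace]
  induction r with
  | zero =>
    intro Q hQ
    refine ⟨Empty, inferInstance, inferInstance, 0, by simp, fun j => by simp, hempty, ?_⟩
    intro ι _ _ Y w hY hYQ
    have := finrank_reach_pos (k := k) hY
    have := hQ ι Y w hY hYQ
    omega
  | succ r ih =>
    intro Q hQ
    by_cases hne : ∃ (ι : Type) (_ : Fintype ι) (_ : DecidableEq ι) (X : Fin g → Matrix ι ι ℝ)
      (v : Fin δ → ι → ℝ), IsBoundaryPair p X v ∧ ∀ q ∈ Q, act X q v = 0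
    swap
    · exact ⟨Empty, inferInstance, inferInstance, 0, by simp, fun j => by simp, hempty,
        fun ι _ _ Y w hY hYQ => (hne ⟨ι, _, _, Y, w, hY, hYQ⟩).elim⟩
    obtain ⟨ι₀, _, _, X₀, v₀, hX₀, hX₀Q⟩ := hne
    obtain ⟨ι, _, _, X, v, hX, hXQ, hdom⟩ := exists_dominating (k + 1) hX₀ hX₀Q
    obtain ⟨A, hA, hApos, q, hq, ⟨a₀, ha₀⟩, hker⟩ := hX.exists_pencil hp hc hk
    have hm := hQ ι X v hX hXQ
    obtain ⟨κ, _, _, B, hcard, hB, hBpos, hBsing⟩ := ih (Q ∪ Set.range q) (by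
      intro κ _ _ Y w hY hYQ
      have hlt : Module.finrank ℝ (reach k Y w) < Module.finrank ℝ (reach k X v) :=
        Submodule.finrank_map_lt_finrank_map (rowLE g δ k) (actHom X v) (actHom Y w)
          (fun s hs => hdom κ Y w hY (fun t ht => hYQ t (Or.inl ht)) s
            (rowLE_mono k.le_succ hs)) (hq a₀) ha₀ (hYQ _ (Or.inr ⟨a₀, rfl⟩))
      omega)
    refine ⟨Fin _ ⊕ κ, inferInstance, inferInstance, dsum A B, ?_, dsum_isSymm hA hB,
      hApos.dsum hBpos, ?_⟩
    · rw [Fintype.card_sum, Fintype.card_fin]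
      nlinarith
    · intro κ' _ _ Y w hY hYQ
      by_cases h0 : ∀ a, act Y (q a) w = 0
      · obtain ⟨Z, hZ, hZ0⟩ := hBsing κ' Y w hY (by
          rintro s (hs | ⟨a, rfl⟩)
          · exact hYQ s hs
          · exact h0 a)
        refine ⟨Matrix.fromCols 0 Z, fun h => hZ ?_, ?_⟩
        · ext i a
          exact congrFun (congrFun h i) (Sum.inr a)
        · rw [pencilOp_dsum, hZ0]
          ext i (a | a) <;> simp [pencilOp]
      · push Not at h0
        obtain ⟨a, ha⟩ := h0
        refine ⟨Matrix.fromCols (Matrix.of fun i a => act Y (q a) w i) 0, fun h => ha ?_, ?_⟩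
        · ext i
          exact congrFun (congrFun h i) (Sum.inl a)
        · have hY0 : pencilOp A Y (Matrix.of fun i a => act Y (q a) w i) = 0 := by
            ext i a
            rw [← act_pencilRow, hdom κ' Y w hY hYQ _ (pencilRow_mem A hq a)]
            · rfl
            · ext j
              rw [act_pencilRow, hker]; rfl
          rw [pencilOp_dsum, hY0]
          ext i (a | a) <;> simp [pencilOp]

lemma zero_mem_dom {p : MatPoly g δ δ} (hp : IsUnit p.evalZero) :
    (0 : Fin g → Matrix ι ι ℝ) ∈ Dom p :=
  ⟨fun j => Matrix.isSymm_zero, fun t _ => by rw [smul_zero]; exact nonsing_zero hp⟩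

lemma dom_subset_invertibilitySet {p : MatPoly g δ δ} {n : ℕ} {X : Fin g → Matrix (Fin n) (Fin n) ℝ}
    (hX : X ∈ Dom p) : X ∈ p.invertibilitySet n := by
  have hsub : (fun t : ℝ => t • X) '' Set.Icc 0 1 ⊆ {X | X ∈ symmTuples g n ∧ IsUnit (p.eval X)} := by
    rintro _ ⟨t, ht, rfl⟩
    exact ⟨fun j => (hX.1 j).smul t, isUnit_blockEval_iff.2 (hX.2 t ht)⟩
  exact (isPreconnected_Icc.image _ (by fun_prop)).subset_connectedComponentIn
    ⟨0, by simp, by simp⟩ hsub ⟨1, by simp, by simp⟩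

lemma invertibilitySet_subset (p : MatPoly g δ δ) (n : ℕ) {X : Fin g → Matrix (Fin n) (Fin n) ℝ}
    (hX : X ∈ p.invertibilitySet n) : (∀ j, (X j).IsSymm) ∧ Nonsing p X := by
  obtain ⟨h1, h2⟩ := connectedComponentIn_subset _ _ hX
  exact ⟨h1, isUnit_blockEval_iff.1 h2⟩

lemma invertibilitySet_eq_dom {p : MatPoly g δ δ} (hp : IsUnit p.evalZero) {n : ℕ}
    (hc : Convex ℝ (p.invertibilitySet n)) : p.invertibilitySet n = Dom p := by
  refine Set.Subset.antisymm (fun X hX => ?_) fun X hX => dom_subset_invertibilitySet hX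
  refine ⟨(invertibilitySet_subset p n hX).1, fun t ht => ?_⟩
  have h0 : (0 : Fin g → Matrix (Fin n) (Fin n) ℝ) ∈ p.invertibilitySet n :=
    dom_subset_invertibilitySet (zero_mem_dom hp)
  exact (invertibilitySet_subset p n (hc.smul_mem_of_zero_mem h0 hX ht)).2

lemma domConvex_of_ncConvex {p : MatPoly g δ δ} (hp : IsUnit p.evalZero)
    (hc : NCConvex p.invertibilitySet) : DomConvex p := by
  intro ι _ _
  rcases isEmpty_or_nonempty ι with hι | hι
  · exact fun X _ Y _ a b _ _ _ => by
      convert zero_mem_dom hp (ι := ι) using 1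
      exact Subsingleton.elim _ _
  · have h := hc (Fintype.card ι) Fintype.card_pos
    rw [invertibilitySet_eq_dom hp h] at h
    exact Dom.convex_of_equiv (Fintype.equivFin ι) h

lemma act_monicPencil {μ : ℕ} (A : Fin g → Matrix (Fin μ) (Fin μ) ℝ) (X : Fin g → Matrix ι ι ℝ)
    (hA : ∀ j, (A j).IsSymm) (v : Fin μ → ι → ℝ) (a : Fin μ) (i : ι) :
    act X (monicPencil A a) v i = pencilOp A X (Matrix.of fun i a => v a i) i a := by
  have h : ∀ b, FreeAlgebra.lift ℝ X (monicPencil A a b) =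
      (1 : Matrix (Fin μ) (Fin μ) ℝ) a b • (1 : Matrix ι ι ℝ) - ∑ j, A j a b • X j := by
    intro b
    rw [monicPencil, Matrix.sub_apply, Matrix.sum_apply, map_sub, map_sum]
    congr 1
    · by_cases hab : a = b <;> simp [Matrix.one_apply, hab]
    · simp
  simp only [act, h, Matrix.sub_mulVec, Finset.sum_sub_distrib, pencilOp, Pi.sub_apply,
    Matrix.sub_apply, Matrix.sum_apply, Matrix.of_apply]
  congr 1
  · rw [Finset.sum_eq_single a]
    · simp
    · intro b _ hb
      rw [Matrix.one_apply_ne hb.symm, zero_smul, Matrix.zero_mulVec]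
    · simp
  · simp only [Matrix.sum_mulVec, Finset.sum_apply]
    rw [Finset.sum_comm]
    refine Finset.sum_congr rfl fun j _ => ?_
    rw [Matrix.mul_apply]
    refine Finset.sum_congr rfl fun b _ => ?_
    rw [Matrix.smul_mulVec, Pi.smul_apply, smul_eq_mul, ← (hA j).apply a b, mul_comm]
    rfl

lemma nonsing_monicPencil_iff {μ : ℕ} {A : Fin g → Matrix (Fin μ) (Fin μ) ℝ}
    {X : Fin g → Matrix ι ι ℝ} (hA : ∀ j, (A j).IsSymm) :
    Nonsing (monicPencil A) X ↔ ∀ Z : Matrix ι (Fin μ) ℝ, pencilOp A X Z = 0 → Z = 0 := by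
  constructor
  · intro h Z hZ
    have := h (fun a i => Z i a) fun a => by
      ext i
      rw [act_monicPencil A X hA]
      exact congrFun (congrFun hZ i) a
    ext i a
    exact congrFun (congrFun this a) i
  · intro h v hv
    have := h (Matrix.of fun i a => v a i) (by
      ext i a
      rw [← act_monicPencil A X hA, hv]; rfl)
    ext a i
    exact congrFun (congrFun this i) a

/-- The domain of `p` lies in the domain of a pencil which is positive semidefinite on it. -/
lemma PencilNonneg.dom_subset {p : MatPoly g δ δ} {μ : ℕ} {A : Fin g → Matrix (Fin μ) (Fin μ) ℝ}
    (hA : ∀ j, (A j).IsSymm) (hpos : PencilNonneg p A) {X : Fin g → Matrix ι ι ℝ}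
    (hX : X ∈ Dom p) : X ∈ Dom (monicPencil A) := by
  refine ⟨hX.1, fun t ht => (nonsing_monicPencil_iff hA).2 fun Z hZ => ?_⟩
  obtain ⟨s, hs, hsX⟩ := exists_one_lt_smul_mem_dom hX
  have h1 := hpos ι _ hsX Z
  have h2 := pencilForm_eq A (t • X) Z
  rw [hZ, Matrix.mul_zero, Matrix.trace_zero] at h2
  rw [pencilForm_smul] at h1 h2
  have h3 := trace_transpose_mul_self_nonneg Z
  apply eq_zero_of_trace_transpose_mul_self
  set b := ∑ j, (A j * (Zᵀ * X j * Z)).trace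
  rcases le_or_gt b 0 with hb | hb
  · nlinarith [mul_nonneg ht.1 (neg_nonneg.2 hb)]
  · nlinarith [mul_nonneg (sub_nonneg.2 ht.2) hb.le, mul_pos (sub_pos.2 hs) hb]

/-- The real-linear symmetrization of a tuple. -/
noncomputable def symmPart (g : ℕ) (ι : Type) :
    (Fin g → Matrix ι ι ℝ) →ₗ[ℝ] (Fin g → Matrix ι ι ℝ) where
  toFun X := fun j => (1 / 2 : ℝ) • (X j + (X j)ᵀ)
  map_add' X Y := by ext; simp; ring
  map_smul' c X := by ext; simp; ring

lemma symmPart_isSymm (X : Fin g → Matrix ι ι ℝ) (j : Fin g) : (symmPart g ι X j).IsSymm := by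
  simp [symmPart, Matrix.IsSymm, add_comm]

lemma symmPart_eq {X : Fin g → Matrix ι ι ℝ} (hX : ∀ j, (X j).IsSymm) : symmPart g ι X = X := by
  ext1 j
  simp only [symmPart, LinearMap.coe_mk, AddHom.coe_mk, (hX j).eq]
  module

lemma invertibilitySet_eq_of_pencil {p : MatPoly g δ δ} (hp : IsUnit p.evalZero)
    (hc : NCConvex p.invertibilitySet) {μ : ℕ} {A : Fin g → Matrix (Fin μ) (Fin μ) ℝ}
    (hA : ∀ j, (A j).IsSymm) (hpos : PencilNonneg p A) (hsing : PencilSingularOn p ∅ A)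
    {n : ℕ} (hn : 0 < n) : p.invertibilitySet n = (monicPencil A).invertibilitySet n := by
  have hdc := domConvex_of_ncConvex hp hc
  rw [invertibilitySet_eq_dom hp (hc n hn)]
  refine Set.Subset.antisymm
    (fun X hX => dom_subset_invertibilitySet (hpos.dom_subset hA hX)) ?_
  set u : Set (Fin g → Matrix (Fin n) (Fin n) ℝ) := symmPart g (Fin n) ⁻¹' Dom p with hu
  have hcont : Continuous (symmPart g (Fin n)) := LinearMap.continuous_of_finiteDimensional _
  have hopen : IsOpen u := by
    have : u = symmPart g (Fin n) ⁻¹' {X | ∀ t ∈ Set.Icc (0 : ℝ) 1, Nonsing p (t • X)} := by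
      ext X
      exact ⟨fun h => h.2, fun h => ⟨symmPart_isSymm X, h⟩⟩
    rw [this]
    exact (isOpen_nonsing_segment p).preimage hcont
  have hconv : Convex ℝ u := (hdc (Fin n)).linear_preimage _
  have h0 : (0 : Fin g → Matrix (Fin n) (Fin n) ℝ) ∈ Dom p := zero_mem_dom hp
  have h0u : (0 : Fin g → Matrix (Fin n) (Fin n) ℝ) ∈ u := by simpa [hu] using h0
  have hsub : (monicPencil A).invertibilitySet n ⊆ u := by
    refine isPreconnected_connectedComponentIn.subset_of_closure_inter_subset hopen
      ⟨0, dom_subset_invertibilitySet (hpos.dom_subset hA h0), h0u⟩ ?_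
    rintro X ⟨hXu, hXL⟩
    obtain ⟨hXs, hXn⟩ := invertibilitySet_subset _ n hXL
    have hray : ∀ t ∈ Set.Ico (0 : ℝ) 1, t • X ∈ Dom p := by
      intro t ht
      have : t • X ∈ interior u := by
        have := hconv.combo_interior_closure_subset_interior (a := 1 - t) (b := t)
          (by linarith [ht.2]) ht.1 (by ring)
        exact this ⟨(1 - t) • 0, ⟨0, by rwa [hopen.interior_eq], rfl⟩, t • X, ⟨X, hXu, rfl⟩,
          by simp⟩
      rw [hopen.interior_eq] at this
      have h2 : symmPart g (Fin n) (t • X) ∈ Dom p := this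
      rwa [symmPart_eq (X := t • X) fun j => (hXs j).smul t] at h2
    change symmPart g (Fin n) X ∈ Dom p
    rw [symmPart_eq hXs]
    by_contra hXp
    have hbad : ¬ Nonsing p X := by
      intro hns
      refine hXp ⟨hXs, fun t ht => ?_⟩
      rcases ht.2.eq_or_lt with rfl | hlt
      · rwa [one_smul]
      · simpa using (hray t ⟨ht.1, hlt⟩).2 1 (by simp)
    simp only [Nonsing, not_forall] at hbad
    obtain ⟨v, hv, hv0⟩ := hbad
    obtain ⟨Z, hZ, hZ0⟩ := hsing (Fin n) X v ⟨hXs, hray, hv0, hv⟩ (by simp)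
    exact hZ ((nonsing_monicPencil_iff hA).1 hXn Z hZ0)
  intro X hX
  have := hsub hX
  change symmPart g (Fin n) X ∈ Dom p at this
  rwa [symmPart_eq (invertibilitySet_subset _ n hX).1] at this

lemma pencilOp_submatrix {ξ : Type} [Fintype ξ] [DecidableEq ξ] (A : Fin g → Matrix κ κ ℝ)
    (e : ξ ≃ κ) (Y : Fin g → Matrix ι ι ℝ) (Z : Matrix ι κ ℝ) :
    pencilOp (fun j => (A j).submatrix e e) Y (Z.submatrix id e) =
      (pencilOp A Y Z).submatrix id e := by
  have : ∀ j, Y j * Z.submatrix id e * (A j).submatrix e e = (Y j * Z * A j).submatrix id e := by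
    intro j
    rw [← Matrix.submatrix_mul_equiv (Y j * Z) (A j) id e e]
    rfl
  ext i a
  simp [pencilOp, this, Matrix.sum_apply]

lemma PencilNonneg.submatrix {ξ : Type} [Fintype ξ] [DecidableEq ξ] {p : MatPoly g δ δ}
    {A : Fin g → Matrix κ κ ℝ} (h : PencilNonneg p A) (e : ξ ≃ κ) :
    PencilNonneg p fun j => (A j).submatrix e e := by
  intro ι _ _ Y hY V
  obtain ⟨W, rfl⟩ : ∃ W : Matrix ι κ ℝ, V = W.submatrix id e :=
    ⟨V.submatrix id e.symm, by ext; simp⟩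
  have h1 := h ι Y hY W
  rw [pencilForm_eq] at h1 ⊢
  rw [pencilOp_submatrix]
  convert h1 using 1
  rw [Matrix.trace, Matrix.trace, ← e.sum_comp]
  rfl

lemma PencilSingularOn.submatrix {ξ : Type} [Fintype ξ] [DecidableEq ξ] {p : MatPoly g δ δ}
    {Q : Set (Fin δ → FreeAlgebra ℝ (Fin g))} {A : Fin g → Matrix κ κ ℝ}
    (h : PencilSingularOn p Q A) (e : ξ ≃ κ) :
    PencilSingularOn p Q fun j => (A j).submatrix e e := by
  intro ι _ _ Y w hY hQ
  obtain ⟨Z, hZ, hZ0⟩ := h ι Y w hY hQ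
  refine ⟨Z.submatrix id e, fun h0 => hZ ?_, by rw [pencilOp_submatrix, hZ0]; rfl⟩
  ext i a
  simpa using congrFun (congrFun h0 i) (e.symm a)

/-- The representation theorem. The argument does not need the domain to be bounded. -/
lemma hasLMIRepresentation_of_compressesBoundary {p : MatPoly g δ δ} (hδ : 0 < δ)
    (hp : IsUnit p.evalZero) (hc : NCConvex p.invertibilitySet) {k : ℕ}
    (hk : CompressesBoundary p k) {ν : ℕ} (hν : ν = δ * ∑ j ∈ Finset.range (k + 1), g ^ j) :
    HasLMIRepresentationOfSizeLE p.invertibilitySet (ν * (ν + 1) / 2) := by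
  obtain ⟨κ, _, _, A, hcard, hA, hpos, hsing⟩ := exists_pencil_of_finrank_reach_le hp
    (domConvex_of_ncConvex hp hc) hk ν ∅ fun ι _ _ X v _ _ => hν ▸ finrank_reach_le k X v
  have hν0 : 1 ≤ ν := by
    rw [hν, Finset.sum_range_succ']
    exact Nat.mul_pos hδ (by simp)
  have hle : ∀ m, m * 2 ≤ ν * (ν + 1) → m ≤ ν * (ν + 1) / 2 := fun m hm =>
    (Nat.le_div_iff_mul_le two_pos).2 hm
  rcases isEmpty_or_nonempty κ with hκ | hκ
  · refine ⟨1, one_pos, hle 1 (by nlinarith), 0, fun j => Matrix.isSymm_zero, fun n hn =>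
      invertibilitySet_eq_of_pencil hp hc (fun j => Matrix.isSymm_zero)
        (fun ι _ _ Y _ V => ?_) (fun ι _ _ Y w hY hQ => ?_) hn⟩
    · simpa [pencilForm] using trace_transpose_mul_self_nonneg V
    · obtain ⟨Z, hZ, -⟩ := hsing ι Y w hY hQ
      exact (hZ (by ext i a; exact hκ.elim a)).elim
  · let e := (Fintype.equivFin κ).symm
    exact ⟨Fintype.card κ, Fintype.card_pos, hle _ hcard, fun j => (A j).submatrix e e,
      fun j => (hA j).submatrix e, fun n hn => invertibilitySet_eq_of_pencil hp hc
        (fun j => (hA j).submatrix e) (hpos.submatrix e) (hsing.submatrix e) hn⟩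

end NCPoly

theorem theorem1p2 (g δ d : ℕ) (hδ : 0 < δ) (p : NCPoly.MatPoly g δ δ)
    (hdeg : p.HasDegreeLE d) (hsymm : p.IsSymmetric)
    (hinv : IsUnit p.evalZero)
    (hbdd : NCPoly.NCBounded p.invertibilitySet)
    (hconv : NCPoly.NCConvex p.invertibilitySet) :
    (∀ ν : ℕ, ν = δ * ∑ j ∈ Finset.range (d + 1), g ^ j →
      NCPoly.HasLMIRepresentationOfSizeLE p.invertibilitySet (ν * (ν + 1) / 2)) ∧
    (p.evalZero = 1 →
      ∀ ν' : ℕ, ν' = δ * ∑ j ∈ Finset.range (d / 2 + 1), g ^ j →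
        NCPoly.HasLMIRepresentationOfSizeLE p.invertibilitySet (ν' * (ν' + 1) / 2)) :=
  ⟨fun _ hν => NCPoly.hasLMIRepresentation_of_compressesBoundary hδ hinv hconv
    (NCPoly.compressesBoundary_of_degree hdeg) hν,
  fun h1 _ hν => NCPoly.hasLMIRepresentation_of_compressesBoundary hδ hinv hconv
    (NCPoly.compressesBoundary_of_half_degree hdeg (by omega) hsymm h1
      (NCPoly.domConvex_of_ncConvex hinv hconv)) hν⟩
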